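/- Consider $\mathbb{Z}^d$ as a graph with nearest-neighbour adjacency; a vertex is odd (even) if its graph distance from the origin $\mathbf 0$ is odd (even). A set $U\subset\mathbb{Z}^d$ is odd (even) if every vertex of $U$ adjacent to a vertex outside $U$ is odd (even), and it is regular if neither $U$ nor $U^c$ induces a subgraph with an isolated vertex. The edge-boundary $\partial U$ is the set of edges with exactly one endpoint in $U$. For an integer $r\ge 1$, an $r$-cutset is a finite regular set $S$ such that both $S$ and $S^c$ are connected in the graph $(\mathbb{Z}^d)^{\otimes r}$, in which two distinct vertices are adjacent if their distance in $\mathbb{Z}^d$ is at most $r$. Let $\mathcal{OC}_{n,r}$ be the collection of odd $r$-cutsets $S$ in $\mathbb{Z}^d$ with $|\partial S|=n$ that contain a vertex at distance at most $r$ from $\mathbf 0$. An approximation is a pair $A=(A_\bullet,A_\circ)$ of disjoint subsets of $\mathbb{Z}^d$ such that $A_\bullet$ is odd and $A_\circ$ is even; it approximates an odd set $S$ if $A_\bullet\subset S$ and $A_\circ\subset S^c$. A $t$-approximation is an approximation $A$ such that the subgraph of $\mathbb{Z}^d$ induced by $A_*:=(A_\bullet\cup A_\circ)^c$ has maximum degree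 at most $t$ and no isolated vertices. Proposition. There exists an absolute constant $C>0$ such that for all integers $d\ge 2$, $n,r\ge 1$ and $1\le t<2d$ there exists a finite family $\mathcal{A}$ of $t$-approximations of size $$|\mathcal{A}|\le \exp\left(Cnr\left(\frac{\log d}{d}\right)^{3/2}+\frac{Cn\log d}{dt}\right)$$ such that every $S\in\mathcal{OC}_{n,r}$ is approximated by some member of $\mathcal{A}$. -/

import Mathlib

namespace OddCutset

variable {V : Type*}

/-- The integer lattice `ℤ^d` as a graph: two vertices are adjacent when they differ by one in
exactly one coordinate. -/
def lattice (d : ℕ) : SimpleGraph (Fin d → ℤ) where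
  Adj u v := ∃ i, |u i - v i| = 1 ∧ ∀ j, j ≠ i → u j = v j
  symm := ⟨by
    rintro u v ⟨i, hi, hj⟩
    exact ⟨i, by rwa [abs_sub_comm], fun j h => (hj j h).symm⟩⟩
  loopless := ⟨by
    rintro u ⟨i, hi, -⟩
    simp at hi⟩

/-- The graph `G^{⊗ r}`: distinct vertices at `G`-distance at most `r` are adjacent
(`edist` is the graph distance, infinite between different components). -/
def distPower (G : SimpleGraph V) (r : ℕ) : SimpleGraph V where
  Adj u v := u ≠ v ∧ G.edist u v ≤ r
  symm := ⟨fun u v h => ⟨h.1.symm, by rw [SimpleGraph.edist_comm]; exact h.2⟩⟩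
  loopless := ⟨fun _ h => h.1 rfl⟩

/-- The subgraph induced by `U` has no isolated vertices. -/
def NoIsolated (G : SimpleGraph V) (U : Set V) : Prop :=
  ∀ v ∈ U, ∃ w ∈ U, G.Adj v w

/-- The internal vertex-boundary of `U`. -/
def innerBoundary (G : SimpleGraph V) (U : Set V) : Set V :=
  {u | u ∈ U ∧ ∃ w ∉ U, G.Adj u w}

/-- The edge-boundary of `U`: the edges with exactly one endpoint in `U`. -/
def edgeBoundary (G : SimpleGraph V) (U : Set V) : Set (Sym2 V) :=
  {e | ∃ u ∈ U, ∃ w ∉ U, G.Adj u w ∧ e = s(u, w)}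

/-- A vertex is odd if its graph distance from the origin is odd. -/
def IsOddVertex {d : ℕ} (v : Fin d → ℤ) : Prop := Odd ((lattice d).dist 0 v)

/-- A vertex is even if its graph distance from the origin is even. -/
def IsEvenVertex {d : ℕ} (v : Fin d → ℤ) : Prop := Even ((lattice d).dist 0 v)

/-- A set is odd if its internal vertex-boundary consists solely of odd vertices. -/
def IsOddSet {d : ℕ} (U : Set (Fin d → ℤ)) : Prop :=
  ∀ v ∈ innerBoundary (lattice d) U, IsOddVertex v

/-- A set is even if its internal vertex-boundary consists solely of even vertices. -/
def IsEvenSet {d : ℕ} (U : Set (Fin d → ℤ)) : Prop :=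
  ∀ v ∈ innerBoundary (lattice d) U, IsEvenVertex v

/-- A set is regular if neither it nor its complement has isolated vertices. -/
def IsRegularSet {d : ℕ} (U : Set (Fin d → ℤ)) : Prop :=
  NoIsolated (lattice d) U ∧ NoIsolated (lattice d) Uᶜ

/-- An `r`-cutset: a finite regular set such that both it and its complement are connected in
`(ℤ^d)^{⊗ r}`. -/
structure IsCutset {d : ℕ} (r : ℕ) (S : Set (Fin d → ℤ)) : Prop where
  finite : S.Finite
  regular : IsRegularSet S
  connected : ((distPower (lattice d) r).induce S).Connected
  coconnected : ((distPower (lattice d) r).induce Sᶜ).Connected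

/-- The collection of odd `r`-cutsets with exactly `n` boundary edges and within distance `r` of
the origin. -/
def oddCutsets (d n r : ℕ) : Set (Set (Fin d → ℤ)) :=
  {S | IsCutset r S ∧ IsOddSet S ∧ (edgeBoundary (lattice d) S).encard = n ∧
    ∃ s ∈ S, (lattice d).edist 0 s ≤ r}

/-- The unknown vertices of a pair `A = (A_•, A_∘)`: those lying in neither of the two sets. -/
def unknown {d : ℕ} (A : Set (Fin d → ℤ) × Set (Fin d → ℤ)) : Set (Fin d → ℤ) :=
  (A.1 ∪ A.2)ᶜ

/-- An approximation: a pair `(A_•, A_∘)` of disjoint sets, the first odd and the second even. -/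
structure IsApproximation {d : ℕ} (A : Set (Fin d → ℤ) × Set (Fin d → ℤ)) : Prop where
  disjoint : Disjoint A.1 A.2
  odd : IsOddSet A.1
  even : IsEvenSet A.2

/-- A `t`-approximation: an approximation such that the subgraph induced by the unknown vertices
has maximum degree at most `t` and no isolated vertices. -/
structure IsTApproximation {d : ℕ} (t : ℕ) (A : Set (Fin d → ℤ) × Set (Fin d → ℤ)) : Prop
    extends IsApproximation A where
  degree_le : ∀ v ∈ unknown A, ((lattice d).neighborSet v ∩ unknown A).encard ≤ t
  noIsolated : NoIsolated (lattice d) (unknown A)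

/-- `A` approximates `S`: `A_• ⊆ S` and `A_∘ ⊆ Sᶜ`. -/
def Approximates {d : ℕ} (A : Set (Fin d → ℤ) × Set (Fin d → ℤ)) (S : Set (Fin d → ℤ)) : Prop :=
  A.1 ⊆ S ∧ A.2 ⊆ Sᶜ

end OddCutset

namespace OddCutset

/-! The boundary of an odd set is rigid: the two ends of a boundary edge together carry at least 2d
boundary edges (`two_mul_le_crossDegree_add`). Hence there are few boundary vertices of degree at
least s = √(d log d), and even fewer of almost full degree. Averaging and greedy domination turn
this into a set U of at most K = O(n √(log d) / d^{3/2}) vertices, near the boundary, whose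
neighbourhood meets every boundary edge (`exists_separating`).

The boundary of an r-cutset is connected at scale r + 1 (`IsCutset.boundary_connected`, by a mod 2
cohomology argument), so U is connected at scale r + 5. Such sets are covered by walks, and a
boundary vertex lies on a short ray from a point of S near the origin; so there are exp(O(r K log
d)) candidates for U. As K log d = O(n (log d / d)^{3/2}), this is the first term of the bound.

Given U, the set S is a union of components off W = N(U). Components with fewer than d vertices add
at most 2|W| vertices to W, and by isoperimetry at most 4|U| finite components are larger. So
2^{4|U|} choices determine S outside a set Y of O(d|U|) vertices (`exists_trace_family`).

Inside Y, an even vertex of S or an odd vertex outside S forces all its neighbours to its own side.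
Revealing a maximal efficient set of such vertices allows every vertex that keeps many unknown
neighbours to be declared of the other kind (`ParityApproximates.exists_prune_reveal`). A round with
threshold d reveals at most |Y|/d = O(K) vertices. After it, every non-forcing unknown vertex has at
least d boundary edges, so there are at most 2n/d of these and a round with threshold t reveals at
most 2n/(dt) vertices. Encoding the second revealed set costs the second term of the bound; all
other costs are absorbed in the first. -/

open Finset

/-! ### The lattice: unit steps, parity, balls -/

/-- The `2d` unit vectors of `ℤ^d`. -/
def step {d : ℕ} (e : Fin d × Bool) : Fin d → ℤ := Pi.single e.1 (if e.2 then 1 else -1)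

lemma step_injective {d : ℕ} : Function.Injective (step (d := d)) := by
  rintro ⟨i, b⟩ ⟨j, c⟩ h
  have hi := congrFun h i
  have hj := congrFun h j
  by_cases hij : i = j
  · subst hij
    simp only [step, Pi.single_eq_same] at hi
    cases b <;> cases c <;> simp_all
  · simp only [step, Pi.single_eq_same, Pi.single_eq_of_ne hij] at hi
    cases b <;> simp at hi

lemma card_steps (d : ℕ) : Fintype.card (Fin d × Bool) = 2 * d := by
  simp [mul_comm]

/-- The opposite unit vector. -/
def negStep {d : ℕ} (e : Fin d × Bool) : Fin d × Bool := (e.1, !e.2)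

lemma step_negStep {d : ℕ} (e : Fin d × Bool) : step (negStep e) = -step e := by
  rcases e with ⟨i, b⟩
  cases b <;> simp [step, negStep, ← Pi.single_neg]

@[simp] lemma add_step_negStep {d : ℕ} (v : Fin d → ℤ) (e : Fin d × Bool) :
    v + step e + step (negStep e) = v := by
  simp [step_negStep]

lemma adj_iff {d : ℕ} {u v : Fin d → ℤ} : (lattice d).Adj u v ↔ ∃ e, v = u + step e := by
  constructor
  · rintro ⟨i, hi, hj⟩
    rcases (abs_eq zero_le_one).1 hi with h | h
    · refine ⟨(i, false), ?_⟩
      ext j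
      by_cases hji : j = i
      · subst hji; simp [step]; omega
      · simp [step, hji, hj j hji]
    · refine ⟨(i, true), ?_⟩
      ext j
      by_cases hji : j = i
      · subst hji; simp [step]; omega
      · simp [step, hji, hj j hji]
  · rintro ⟨⟨i, b⟩, rfl⟩
    refine ⟨i, ?_, fun j hj => ?_⟩
    · cases b <;> simp [step]
    · simp [step, hj]

lemma adj_step {d : ℕ} (u : Fin d → ℤ) (e : Fin d × Bool) : (lattice d).Adj u (u + step e) :=
  adj_iff.2 ⟨e, rfl⟩

/-- Induction over `ℤ^d` along unit vectors. -/
lemma lattice_induction {d : ℕ} {p : (Fin d → ℤ) → Prop} (h0 : p 0)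
    (h : ∀ v e, p v → p (v + step e)) (v : Fin d → ℤ) : p v := by
  have key : ∀ (i : Fin d) (n : ℤ) (u : Fin d → ℤ), p u → p (u + Pi.single i n) := by
    intro i n
    induction n using Int.induction_on with
    | zero => intro u hu; simpa using hu
    | succ k ih =>
      intro u hu
      have := h _ (i, true) (ih u hu)
      simpa [step, add_assoc, ← Pi.single_add] using this
    | pred k ih =>
      intro u hu
      have := h _ (i, false) (ih u hu)
      simpa [step, add_assoc, ← Pi.single_add, sub_eq_add_neg] using this
  have key2 : ∀ s : Finset (Fin d), p (∑ i ∈ s, Pi.single i (v i)) := by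
    intro s
    induction s using Finset.induction_on with
    | empty => simpa using h0
    | insert a s ha ih =>
      rw [Finset.sum_insert ha, add_comm]
      exact key _ _ _ ih
  have := key2 Finset.univ
  rwa [Finset.univ_sum_single] at this

lemma lattice_preconnected (d : ℕ) : (lattice d).Preconnected := by
  have h : ∀ v, (lattice d).Reachable 0 v :=
    lattice_induction (SimpleGraph.Reachable.refl _)
      fun v e hv => hv.trans (adj_step v e).reachable
  exact fun u v => (h u).symm.trans (h v)

lemma sum_step_odd {d : ℕ} (e : Fin d × Bool) : Odd (∑ i, step e i) := by
  rcases e with ⟨i, b⟩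
  cases b <;> simp [step]

lemma even_sum_add_step {d : ℕ} (v : Fin d → ℤ) (e : Fin d × Bool) :
    Even (∑ i, (v + step e) i) ↔ ¬ Even (∑ i, v i) := by
  have := Int.not_even_iff_odd.2 (sum_step_odd e)
  simp only [Pi.add_apply, Finset.sum_add_distrib, Int.even_add, this, iff_false]

lemma even_length_iff {d : ℕ} {u v : Fin d → ℤ} (p : (lattice d).Walk u v) :
    Even p.length ↔ (Even (∑ i, u i) ↔ Even (∑ i, v i)) := by
  induction p with
  | nil => simp
  | cons h p ih =>
    obtain ⟨e, rfl⟩ := adj_iff.1 h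
    rw [SimpleGraph.Walk.length_cons, Nat.even_add_one, ih, even_sum_add_step]
    tauto

lemma isEvenVertex_iff {d : ℕ} (v : Fin d → ℤ) : IsEvenVertex v ↔ Even (∑ i, v i) := by
  obtain ⟨p, hp⟩ := (lattice_preconnected d 0 v).exists_walk_length_eq_dist
  rw [IsEvenVertex, ← hp, even_length_iff]
  simp

lemma isOddVertex_iff {d : ℕ} (v : Fin d → ℤ) : IsOddVertex v ↔ ¬ Even (∑ i, v i) := by
  rw [← isEvenVertex_iff, IsOddVertex, IsEvenVertex, Nat.not_even_iff_odd]

/-- Two vertices of the lattice are at graph distance at most `k`. -/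
def Near {d : ℕ} (k : ℕ) (u v : Fin d → ℤ) : Prop := (lattice d).edist u v ≤ k

lemma near_refl {d : ℕ} (k : ℕ) (u : Fin d → ℤ) : Near k u u := by simp [Near]

lemma Near.symm {d k : ℕ} {u v : Fin d → ℤ} (h : Near k u v) : Near k v u := by
  rwa [Near, SimpleGraph.edist_comm]

lemma Near.trans {d k l : ℕ} {u v w : Fin d → ℤ} (h : Near k u v) (h' : Near l v w) :
    Near (k + l) u w := by
  refine (SimpleGraph.edist_triangle (v := v)).trans ?_
  push_cast
  exact add_le_add h h'

lemma Near.mono {d k l : ℕ} {u v : Fin d → ℤ} (h : Near k u v) (hkl : k ≤ l) : Near l u v :=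
  le_trans (α := ℕ∞) h (by exact_mod_cast hkl)

lemma near_of_walk {d : ℕ} {u v : Fin d → ℤ} (p : (lattice d).Walk u v) : Near p.length u v :=
  p.edist_le

lemma near_step {d : ℕ} (u : Fin d → ℤ) (e : Fin d × Bool) : Near 1 u (u + step e) :=
  near_of_walk (adj_step u e).toWalk

lemma Near.exists_walk {d k : ℕ} {u v : Fin d → ℤ} (h : Near k u v) :
    ∃ p : (lattice d).Walk u v, p.length ≤ k := by
  obtain ⟨p, hp⟩ := (lattice_preconnected d u v).exists_walk_length_eq_edist
  refine ⟨p, ?_⟩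
  have : (p.length : ℕ∞) ≤ k := hp ▸ h
  exact_mod_cast this

lemma near_of_mem_support {d : ℕ} {u v : Fin d → ℤ} (p : (lattice d).Walk u v) :
    ∀ x ∈ p.support, ∀ y ∈ p.support, Near p.length x y := by
  induction p with
  | nil => simp [near_refl]
  | @cons u v w h p ih =>
    have h1 : Near 1 u v := near_of_walk h.toWalk
    have key : ∀ y ∈ p.support, Near (p.length + 1) u y := fun y hy =>
      (h1.trans (ih v p.start_mem_support y hy)).mono (by omega)
    simp only [SimpleGraph.Walk.support_cons, List.mem_cons, SimpleGraph.Walk.length_cons]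
    rintro x (rfl | hx) y (rfl | hy)
    · exact near_refl _ _
    · exact key y hy
    · exact (key x hx).symm
    · exact (ih x hx y hy).mono (by omega)

open Classical in
/-- The ball of radius `k` about `u`. -/
noncomputable def ball {d : ℕ} : ℕ → (Fin d → ℤ) → Finset (Fin d → ℤ)
  | 0, u => {u}
  | k + 1, u => (ball k u).biUnion fun v => insert v (univ.image fun e => v + step e)

lemma mem_ball {d k : ℕ} {u v : Fin d → ℤ} (h : Near k u v) : v ∈ ball k u := by
  classical
  induction k generalizing v with
  | zero =>
    obtain ⟨p, hp⟩ := h.exists_walk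
    cases p with
    | nil => simp [ball]
    | cons => simp at hp
  | succ k ih =>
    obtain ⟨p, hp⟩ := h.symm.exists_walk
    simp only [ball, mem_biUnion, mem_insert, mem_image, mem_univ, true_and]
    cases p with
    | nil => exact ⟨u, ih (near_refl _ _), Or.inl rfl⟩
    | @cons _ w _ h p =>
      obtain ⟨e, he⟩ := adj_iff.1 h.symm
      refine ⟨w, ih ((near_of_walk p).symm.mono (by simpa using hp)), Or.inr ⟨e, he.symm⟩⟩

lemma card_ball_le {d : ℕ} (k : ℕ) (u : Fin d → ℤ) : (ball k u).card ≤ (2 * d + 1) ^ k := by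
  classical
  induction k with
  | zero => simp [ball]
  | succ k ih =>
    rw [ball, pow_succ]
    refine (card_biUnion_le_card_mul _ _ (2 * d + 1) fun v _ => ?_).trans
      (Nat.mul_le_mul_right _ ih)
    refine (card_insert_le _ _).trans (Nat.succ_le_succ (card_image_le.trans ?_))
    rw [card_univ, card_steps]


/-! ### Mod 2 potentials and connectivity of the boundary -/

/-- A closed `ℤ/2`-valued one-form on `ℤ^d` is exact. -/
lemma exists_potential {d : ℕ} (a : Fin d → (Fin d → ℤ) → ZMod 2)
    (h : ∀ i j v, a i v + a j (v + step (i, true)) = a j v + a i (v + step (j, true))) :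
    ∃ f : (Fin d → ℤ) → ZMod 2, ∀ i v, f (v + step (i, true)) = f v + a i v := by
  -- Each unit translation is lifted to ℤ^d × ℤ/2, twisted in the fibre by `a i`. Closedness says
  -- that the lifts commute, so they generate an action of ℤ^d; the potential is the fibre
  -- coordinate along the orbit of (0, 0).
  let T : Fin d → Equiv.Perm ((Fin d → ℤ) × ZMod 2) := fun i =>
    { toFun := fun x => (x.1 + step (i, true), x.2 + a i x.1)
      invFun := fun x => (x.1 - step (i, true), x.2 - a i (x.1 - step (i, true)))
      left_inv := fun x => by simp
      right_inv := fun x => by simp }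
  have hT : ∀ i x, T i x = (x.1 + step (i, true), x.2 + a i x.1) := fun _ _ => rfl
  have hcomm : ∀ i j, Commute (T i) (T j) := by
    intro i j
    ext1 x
    simp only [Equiv.Perm.mul_apply, hT, Prod.mk.injEq]
    refine ⟨by abel, ?_⟩
    rw [add_assoc, add_assoc, h]
  have hpow : Pairwise fun i j => ∀ x y : Multiplicative ℤ,
      Commute (zpowersHom _ (T i) x) (zpowersHom _ (T j) y) := by
    intro i j _ x y
    rw [zpowersHom_apply, zpowersHom_apply]
    exact (hcomm i j).zpow_zpow _ _
  obtain ⟨F, hF⟩ : ∃ F : (Fin d → Multiplicative ℤ) →* Equiv.Perm ((Fin d → ℤ) × ZMod 2),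
      ∀ i, F (Pi.mulSingle i (Multiplicative.ofAdd 1)) = T i := by
    refine ⟨MonoidHom.noncommPiCoprod (fun i => zpowersHom _ (T i)) hpow, fun i => ?_⟩
    rw [MonoidHom.noncommPiCoprod_mulSingle, zpowersHom_apply, toAdd_ofAdd, zpow_one]
  let G : (Fin d → ℤ) → (Fin d → ℤ) × ZMod 2 := fun v => F (fun i => Multiplicative.ofAdd (v i)) 0
  have hG : ∀ i v, G (v + step (i, true)) = T i (G v) := by
    intro i v
    have h1 : (fun j => Multiplicative.ofAdd ((v + step (i, true)) j)) =
        Pi.mulSingle i (Multiplicative.ofAdd (1 : ℤ)) * fun j => Multiplicative.ofAdd (v j) := by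
      ext j
      by_cases hj : j = i
      · subst hj; simp [step, mul_comm]
      · simp [step, hj]
    simp only [G, h1, map_mul, hF, Equiv.Perm.mul_apply]
  have hG1 : ∀ v, (G v).1 = v := by
    refine lattice_induction ?_ ?_
    · simp only [G]
      have : (fun i : Fin d => Multiplicative.ofAdd ((0 : Fin d → ℤ) i)) = 1 := rfl
      rw [this, map_one]
      rfl
    · rintro v ⟨i, b⟩ hv
      cases b with
      | true => rw [hG, hT, hv]
      | false =>
        have h2 : v + step (i, false) + step (i, true) = v :=
          add_step_negStep v (i, false)
        have h3 := hG i (v + step (i, false))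
        rw [h2, hT] at h3
        have h4 := congrArg Prod.fst h3
        simp only [hv] at h4
        refine add_right_cancel (b := step (i, true)) ?_
        rw [← h4, h2]
  refine ⟨fun v => (G v).2, fun i v => ?_⟩
  simp only [hG, hT, hG1]

lemma eq_of_walk {d : ℕ} {α : Type*} (f : (Fin d → ℤ) → α) {u v : Fin d → ℤ}
    (p : (lattice d).Walk u v)
    (h : ∀ i, ∀ x ∈ p.support, x + step (i, true) ∈ p.support → f x = f (x + step (i, true))) :
    f u = f v := by
  induction p with
  | nil => rfl
  | @cons u v w huv p ih =>
    simp only [SimpleGraph.Walk.support_cons, List.mem_cons] at h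
    rw [← ih fun i x hx hx' => h i x (Or.inr hx) (Or.inr hx')]
    obtain ⟨⟨i, b⟩, rfl⟩ := adj_iff.1 huv
    cases b with
    | true => exact h i u (Or.inl rfl) (Or.inr p.start_mem_support)
    | false =>
      have h2 : u + step (i, false) + step (i, true) = u := add_step_negStep u (i, false)
      have := h i (u + step (i, false)) (Or.inr p.start_mem_support) (Or.inl h2)
      rw [h2] at this
      exact this.symm

/-- The step `e` at `v` crosses the boundary of `S`. -/
def Crosses {d : ℕ} (S : Set (Fin d → ℤ)) (v : Fin d → ℤ) (e : Fin d × Bool) : Prop :=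
  ¬ (v ∈ S ↔ v + step e ∈ S)

lemma crosses_negStep {d : ℕ} {S : Set (Fin d → ℤ)} {v : Fin d → ℤ} {e : Fin d × Bool} :
    Crosses S (v + step e) (negStep e) ↔ Crosses S v e := by
  simp only [Crosses, add_step_negStep]
  tauto

/-- The vertices incident to a boundary edge of `S`. -/
def boundaryVertices {d : ℕ} (S : Set (Fin d → ℤ)) : Set (Fin d → ℤ) := {v | ∃ e, Crosses S v e}

lemma Crosses.left_mem {d : ℕ} {S : Set (Fin d → ℤ)} {v : Fin d → ℤ} {e : Fin d × Bool}
    (h : Crosses S v e) : v ∈ boundaryVertices S := ⟨e, h⟩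

lemma Crosses.right_mem {d : ℕ} {S : Set (Fin d → ℤ)} {v : Fin d → ℤ} {e : Fin d × Bool}
    (h : Crosses S v e) : v + step e ∈ boundaryVertices S := ⟨negStep e, crosses_negStep.2 h⟩

lemma constant_of_induce_connected {d r : ℕ} {S : Set (Fin d → ℤ)} {α : Type*}
    (hS : ((distPower (lattice d) r).induce S).Connected) (f : (Fin d → ℤ) → α)
    (hf : ∀ u ∈ S, ∀ v ∈ S, Near r u v → f u = f v) : ∀ u ∈ S, ∀ v ∈ S, f u = f v := by
  intro u hu v hv
  obtain ⟨p⟩ := hS.preconnected ⟨u, hu⟩ ⟨v, hv⟩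
  have : ∀ {x y : S}, ((distPower (lattice d) r).induce S).Walk x y → f x = f y := by
    intro x y p
    induction p with
    | nil => rfl
    | @cons x y z h p ih => rw [← ih]; exact hf x x.2 y y.2 h.2
  exact this p

/-- The boundary of an `r`-cutset is connected at scale `r + 1`. -/
lemma IsCutset.boundary_connected {d r : ℕ} (hr : 1 ≤ r) {S : Set (Fin d → ℤ)}
    (hS : IsCutset r S) {P : Set (Fin d → ℤ)} (hPne : P.Nonempty)
    (hPD : P ⊆ boundaryVertices S)
    (hP : ∀ x ∈ P, ∀ y ∈ boundaryVertices S, Near (r + 1) x y → y ∈ P) :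
    P = boundaryVertices S := by
  classical
  -- `a` is the part supported on `P` of the coboundary of `g`, the indicator of `S`. Near `P` it
  -- agrees with that coboundary, and on squares away from `P` it vanishes, so it is closed.
  let a : Fin d → (Fin d → ℤ) → ZMod 2 := fun i v =>
    if Crosses S v (i, true) ∧ v ∈ P then 1 else 0
  let g : (Fin d → ℤ) → ZMod 2 := fun v => if v ∈ S then 1 else 0
  have ha0 : ∀ i v, v ∉ P → a i v = 0 := fun i v hv => by simp [a, hv]
  have h2 : (1 : ZMod 2) + 1 = 0 := rfl
  have ha1 : ∀ x ∈ P, ∀ i v, Near (r + 1) x v → a i v = g v + g (v + step (i, true)) := by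
    intro x hx i v hxv
    by_cases hc : Crosses S v (i, true)
    · have hv : v ∈ P := hP x hx v hc.left_mem hxv
      simp only [a, g, hc, hv, and_self, if_true]
      unfold Crosses at hc
      by_cases h1 : v ∈ S <;> by_cases h3 : v + step (i, true) ∈ S <;> simp_all
    · simp only [a, g, hc, false_and, if_false]
      unfold Crosses at hc
      by_cases h1 : v ∈ S <;> by_cases h3 : v + step (i, true) ∈ S <;> simp_all
  have hclosed : ∀ i j v,
      a i v + a j (v + step (i, true)) = a j v + a i (v + step (j, true)) := by
    intro i j v
    by_cases hx : ∃ x ∈ P, x = v ∨ x = v + step (i, true) ∨ x = v + step (j, true)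
    · obtain ⟨x, hxP, hx⟩ := hx
      have n1 : Near 1 x v := by
        rcases hx with rfl | rfl | rfl
        · exact near_refl _ _
        · exact (near_step _ _).symm
        · exact (near_step _ _).symm
      -- Points of the square may be at distance 2 from `x`; this is where `1 ≤ r` enters.
      have n2 : ∀ k, Near (r + 1) x (v + step k) := fun k =>
        (n1.trans (near_step v k)).mono (by omega)
      rw [ha1 x hxP i v (n1.mono (by omega)), ha1 x hxP j v (n1.mono (by omega)),
        ha1 x hxP _ _ (n2 _), ha1 x hxP _ _ (n2 _),
        add_right_comm v (step (j, true)) (step (i, true))]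
      generalize g v = p, g (v + step (i, true)) = q, g (v + step (j, true)) = s,
        g (v + step (i, true) + step (j, true)) = t
      revert p q s t
      decide
    · push Not at hx
      have n : ∀ x, (x = v ∨ x = v + step (i, true) ∨ x = v + step (j, true)) → x ∉ P := by
        intro x hx' hxP
        obtain ⟨k1, k2, k3⟩ := hx x hxP
        tauto
      rw [ha0 _ _ (n _ (Or.inl rfl)), ha0 _ _ (n _ (Or.inl rfl)),
        ha0 _ _ (n _ (Or.inr (Or.inl rfl))), ha0 _ _ (n _ (Or.inr (Or.inr rfl)))]
  obtain ⟨f, hf⟩ := exists_potential a hclosed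
  -- A walk of length at most `r` that meets `P` stays within `r` of it, so `f + g` is constant
  -- along it; a walk that misses `P` sees only `a = 0`. Thus `f` is constant on `S` and on its
  -- complement.
  have hloc : ∀ u v, (u ∈ S ↔ v ∈ S) → Near r u v → f u = f v := by
    intro u v huv hn
    obtain ⟨p, hp⟩ := hn.exists_walk
    by_cases hx : ∃ x ∈ p.support, x ∈ P
    · obtain ⟨x, hxp, hxP⟩ := hx
      have key : f u + g u = f v + g v := by
        refine eq_of_walk (fun z => f z + g z) p fun i y hy _ => ?_
        rw [hf, ha1 x hxP i y ((near_of_mem_support p x hxp y hy).mono (by omega))]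
        generalize f y = p, g y = q, g (y + step (i, true)) = s
        revert p q s
        decide
      have hg : g u = g v := by simp only [g, huv]
      rw [hg] at key
      exact add_right_cancel key
    · push Not at hx
      exact eq_of_walk f p fun i y hy _ => by rw [hf, ha0 i y (hx y hy), add_zero]
  have hin := constant_of_induce_connected hS.connected f
    fun u hu v hv h => hloc u v (by simp [hu, hv]) h
  have hout := constant_of_induce_connected hS.coconnected f
    fun u hu v hv h => hloc u v (by
      rw [Set.mem_compl_iff] at hu hv
      simp [hu, hv]) h
  -- The increment of `f` is therefore the same across all boundary edges. It equals 1 exactly at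
  -- the edges of `P`, and `P` has one.
  have hcross : ∀ u e u' e', Crosses S u e → Crosses S u' e' →
      f u + f (u + step e) = f u' + f (u' + step e') := by
    intro u e u' e' h h'
    unfold Crosses at h h'
    by_cases h1 : u ∈ S <;> by_cases h1' : u' ∈ S
    · rw [hin u h1 u' h1', hout (u + step e) (by simp only [Set.mem_compl_iff]; tauto)
        (u' + step e') (by simp only [Set.mem_compl_iff]; tauto)]
    · rw [hin u h1 (u' + step e') (by tauto), hout (u + step e)
        (by simp only [Set.mem_compl_iff]; tauto) u' h1', add_comm]
    · rw [hin (u + step e) (by tauto) u' h1', hout u h1 (u' + step e')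
        (by simp only [Set.mem_compl_iff]; tauto), add_comm]
    · rw [hin (u + step e) (by tauto) (u' + step e') (by tauto), hout u h1 u' h1']
  have hPiff : ∀ u e, Crosses S u e → (f u + f (u + step e) = 1 ↔ u ∈ P) := by
    intro u e hc
    have hu1 : u + step e ∈ P ↔ u ∈ P :=
      ⟨fun h => hP _ h _ hc.left_mem ((near_step u e).symm.mono (by omega)),
        fun h => hP _ h _ hc.right_mem ((near_step u e).mono (by omega))⟩
    rcases e with ⟨i, b⟩
    cases b with
    | true =>
      rw [hf]
      by_cases hu : u ∈ P
      · simp only [a, hc, hu, and_self, if_true, iff_true]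
        generalize f u = p
        revert p
        decide
      · rw [ha0 i u hu]
        simp only [hu, iff_false]
        generalize f u = p
        revert p
        decide
    | false =>
      have h3 : u + step (i, false) + step (i, true) = u := add_step_negStep u (i, false)
      have h4 := hf i (u + step (i, false))
      have hc' : Crosses S (u + step (i, false)) (i, true) := crosses_negStep.2 hc
      rw [h3] at h4
      rw [h4, ← hu1]
      by_cases hu : u + step (i, false) ∈ P
      · simp only [a, hc', hu, and_self, if_true, iff_true]
        generalize f (u + step (i, false)) = p
        revert p
        decide
      · rw [ha0 _ _ hu]
        simp only [hu, iff_false]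
        generalize f (u + step (i, false)) = p
        revert p
        decide
  refine hPD.antisymm ?_
  rintro v ⟨e, hv⟩
  obtain ⟨x, hx⟩ := hPne
  obtain ⟨e', hx'⟩ := hPD hx
  rw [← hPiff v e hv, hcross v e x e' hv hx', hPiff x e' hx']
  exact hx


/-! ### Boundary degrees of odd sets -/

/-- The even vertices, described by the parity of the coordinate sum. -/
def evenVertices (d : ℕ) : Set (Fin d → ℤ) := {v | Even (∑ i, v i)}

/-- `Ev` is one of the two parity classes of the lattice. -/
def IsParityClass {d : ℕ} (Ev : Set (Fin d → ℤ)) : Prop := ∀ v e, v + step e ∈ Ev ↔ v ∉ Ev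

lemma isParityClass_evenVertices (d : ℕ) : IsParityClass (evenVertices d) :=
  even_sum_add_step

lemma IsParityClass.compl {d : ℕ} {Ev : Set (Fin d → ℤ)} (h : IsParityClass Ev) :
    IsParityClass Evᶜ := fun v e => not_congr (h v e)

/-- A regular set whose boundary edges lead from outside `Ev` (in `S`) to `Ev` (outside `S`). -/
structure IsParityRegular {d : ℕ} (S Ev : Set (Fin d → ℤ)) : Prop where
  mem_closed : ∀ v ∈ S, v ∈ Ev → ∀ e, v + step e ∈ S
  notMem_closed : ∀ v ∉ S, v ∉ Ev → ∀ e, v + step e ∉ S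
  mem_neighbor : ∀ v ∈ S, ∃ e, v + step e ∈ S
  notMem_neighbor : ∀ v ∉ S, ∃ e, v + step e ∉ S

lemma isParityRegular_of_isOddSet {d : ℕ} {S : Set (Fin d → ℤ)} (hreg : IsRegularSet S)
    (hodd : IsOddSet S) : IsParityRegular S (evenVertices d) where
  mem_closed v hv hev e := by
    by_contra h
    exact (isOddVertex_iff v).1 (hodd v ⟨hv, _, h, adj_step v e⟩) hev
  notMem_closed v hv hev e h := by
    refine (isOddVertex_iff _).1 (hodd _ ⟨h, v, hv, (adj_step v e).symm⟩) ?_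
    exact (isParityClass_evenVertices d v e).2 hev
  mem_neighbor v hv := by
    obtain ⟨w, hw, h⟩ := hreg.1 v hv
    obtain ⟨e, rfl⟩ := adj_iff.1 h
    exact ⟨e, hw⟩
  notMem_neighbor v hv := by
    obtain ⟨w, hw, h⟩ := hreg.2 v hv
    obtain ⟨e, rfl⟩ := adj_iff.1 h
    exact ⟨e, hw⟩

open Classical in
/-- The number of boundary edges of `S` at `v`. -/
noncomputable def crossDegree {d : ℕ} (S : Set (Fin d → ℤ)) (v : Fin d → ℤ) : ℕ :=
  (univ.filter (Crosses S v)).card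

/-- Each boundary edge is counted once from either side: a side contains only one endpoint of it, so
the passage to unordered edges is injective there. -/
lemma sum_crossDegree_le {d n : ℕ} {S : Set (Fin d → ℤ)}
    (hn : (edgeBoundary (lattice d) S).encard = n) (X : Finset (Fin d → ℤ)) :
    ∑ v ∈ X, crossDegree S v ≤ 2 * n := by
  classical
  have hfin : (edgeBoundary (lattice d) S).Finite := Set.finite_of_encard_eq_coe hn
  have hcard : hfin.toFinset.card = n := by
    rw [hfin.encard_eq_coe_toFinset_card] at hn
    exact_mod_cast hn
  have key : ∀ (Q : Set (Fin d → ℤ)), (∀ v ∈ Q, ∀ e, Crosses S v e →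
      s(v, v + step e) ∈ edgeBoundary (lattice d) S ∧ v + step e ∉ Q) →
      ∑ v ∈ X.filter (· ∈ Q), crossDegree S v ≤ n := by
    intro Q hQ
    simp only [crossDegree]
    rw [← card_sigma, ← hcard]
    refine card_le_card_of_injOn (fun p => s(p.1, p.1 + step p.2)) ?_ ?_
    · rintro ⟨v, e⟩ h
      simp only [coe_sigma, Set.mem_sigma_iff, mem_coe, mem_filter, mem_univ, true_and] at h
      simpa using (hQ v h.1.2 e h.2).1
    · rintro ⟨v, e⟩ h ⟨v', e'⟩ h' heq
      simp only [coe_sigma, Set.mem_sigma_iff, mem_coe, mem_filter, mem_univ, true_and] at h h'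
      simp only [Sym2.eq_iff] at heq
      rcases heq with ⟨rfl, h2⟩ | ⟨h1, h2⟩
      · rw [step_injective (add_left_cancel h2)]
      · exact absurd (h1 ▸ h.1.2) (hQ v' h'.1.2 e' h'.2).2
  have h1 := key S fun v hv e hc => by
    have hc' : v + step e ∉ S := by unfold Crosses at hc; tauto
    exact ⟨⟨v, hv, _, hc', adj_step v e, rfl⟩, hc'⟩
  have h2 := key Sᶜ fun v hv e hc => by
    rw [Set.mem_compl_iff] at hv
    have hc' : v + step e ∈ S := by unfold Crosses at hc; tauto
    exact ⟨⟨_, hc', v, hv, (adj_step v e).symm, Sym2.eq_swap⟩, fun h => h hc'⟩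
  have h3 := sum_filter_add_sum_filter_not X (· ∈ S) (crossDegree S)
  simp only [Set.mem_compl_iff] at h2
  omega

lemma card_mul_le_of_le_crossDegree {d n : ℕ} {S : Set (Fin d → ℤ)}
    (hn : (edgeBoundary (lattice d) S).encard = n) (X : Finset (Fin d → ℤ)) {m : ℝ}
    (hX : ∀ v ∈ X, m ≤ crossDegree S v) : X.card * m ≤ 2 * n := by
  have h1 : X.card * m ≤ ∑ v ∈ X, (crossDegree S v : ℝ) := by
    rw [← nsmul_eq_mul]
    exact card_nsmul_le_sum _ _ _ hX
  have h2 := sum_crossDegree_le hn X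
  calc _ ≤ _ := h1
    _ = ((∑ v ∈ X, crossDegree S v : ℕ) : ℝ) := by push_cast; rfl
    _ ≤ ((2 * n : ℕ) : ℝ) := by exact_mod_cast h2
    _ = 2 * n := by push_cast; rfl

lemma boundaryVertices_finite {d n : ℕ} {S : Set (Fin d → ℤ)}
    (hn : (edgeBoundary (lattice d) S).encard = n) : (boundaryVertices S).Finite := by
  by_contra h
  obtain ⟨X, hX, hXc⟩ := Set.Infinite.exists_subset_card_eq h (2 * n + 1)
  have := card_mul_le_of_le_crossDegree hn X (m := 1) fun v hv => by
    obtain ⟨e, he⟩ := hX hv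
    have : 0 < crossDegree S v := card_pos.2 ⟨e, by simpa using he⟩
    exact_mod_cast this
  rw [hXc] at this
  push_cast at this
  linarith

/-- Translate the edge by any `f`. If `v + step f` is across the boundary from `v`, then `f` crosses
at `v`. Otherwise its parity puts all its neighbours on the side of `v`, among them `v + step e +
step f`, so `f` crosses at `v + step e`. -/
lemma two_mul_le_crossDegree_add {d : ℕ} {S Ev : Set (Fin d → ℤ)} (hEv : IsParityClass Ev)
    (hS : IsParityRegular S Ev) {v : Fin d → ℤ} {e : Fin d × Bool} (h : Crosses S v e) :
    2 * d ≤ crossDegree S v + crossDegree S (v + step e) := by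
  classical
  have key : ∀ f, Crosses S v f ∨ Crosses S (v + step e) f := by
    intro f
    have hc := add_right_comm v (step e) (step f)
    have h1 := hEv v e
    have h2 := hEv v f
    have a1 := hS.mem_closed v
    have a2 := hS.notMem_closed v
    have b1 := fun x y => hS.mem_closed (v + step f) x y e
    have b2 := fun x y => hS.notMem_closed (v + step f) x y e
    unfold Crosses at h ⊢
    rw [hc]
    by_cases hv : v ∈ S
    · have : v ∉ Ev := fun hh => h (by simp [hv, a1 hv hh e])
      tauto
    · have : v ∈ Ev := by
        by_contra hh
        exact h (by simp [hv, a2 hv hh e])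
      tauto
  rw [← card_steps, ← card_univ]
  refine le_trans (card_le_card fun f _ => ?_) (card_union_le _ _)
  simpa using key f

lemma Crosses.mem_iff_notMem {d : ℕ} {S Ev : Set (Fin d → ℤ)} (hS : IsParityRegular S Ev)
    {v : Fin d → ℤ} {e : Fin d × Bool} (h : Crosses S v e) : v ∈ S ↔ v ∉ Ev := by
  constructor
  · intro hv hv'
    exact h (by simp [hv, hS.mem_closed v hv hv' e])
  · intro hv'
    by_contra hv
    exact h (by simp [hv, hS.notMem_closed v hv hv' e])

/-- A boundary vertex has the parity of its side's boundary, so a neighbour on the same side has the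
parity that never touches the boundary. -/
lemma Crosses.neighbor_side {d : ℕ} {S Ev : Set (Fin d → ℤ)} (hEv : IsParityClass Ev)
    (hS : IsParityRegular S Ev) {v : Fin d → ℤ} {e e' : Fin d × Bool} (h : Crosses S v e)
    (he' : v ∈ S ↔ v + step e' ∈ S) (f : Fin d × Bool) :
    v + step e' + step f ∈ S ↔ v + step e' ∈ S := by
  have h1 := hEv v e'
  have h2 := h.mem_iff_notMem hS
  by_cases hv : v ∈ S
  · have h3 := he'.1 hv
    simp only [h3, iff_true]
    exact hS.mem_closed _ h3 (h1.2 (h2.1 hv)) f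
  · have h3 : v + step e' ∉ S := fun h => hv (he'.2 h)
    simp only [h3, iff_false]
    exact hS.notMem_closed _ h3 (fun h4 => hv (h2.2 (h1.1 h4))) f

/-! ### Greedy domination -/

/-- Greedy domination. -/
lemma exists_greedy {α β : Type*} (H : Finset α) (B : Finset β) (rel : α → β → Prop)
    [∀ a b, Decidable (rel a b)] (hH : H.Nonempty) {m : ℝ} (hmH : m ≤ H.card)
    (hB : ∀ b ∈ B, m ≤ (H.filter (rel · b)).card) (k : ℕ) :
    ∃ U ⊆ H, U.card ≤ k ∧
      ((B.filter fun b => ∀ u ∈ U, ¬ rel u b).card : ℝ) ≤ B.card * (1 - m / H.card) ^ k := by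
  classical
  have hH0 : (0 : ℝ) < H.card := by exact_mod_cast hH.card_pos
  induction k with
  | zero => exact ⟨∅, empty_subset _, by simp, by simp⟩
  | succ k ih =>
    obtain ⟨U, hUH, hUk, hU⟩ := ih
    set B' := B.filter fun b => ∀ u ∈ U, ¬ rel u b with hB'
    have hdc : ∑ h ∈ H, ((B'.filter (rel h)).card : ℝ) =
        ∑ b ∈ B', ((H.filter (rel · b)).card : ℝ) := by
      exact_mod_cast sum_card_bipartiteAbove_eq_sum_card_bipartiteBelow rel
    -- By averaging, some `h` covers at least a fraction `m / |H|` of what is still uncovered.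
    obtain ⟨h, hhH, hh⟩ : ∃ h ∈ H, m * B'.card / H.card ≤ ((B'.filter (rel h)).card : ℝ) := by
      refine exists_le_of_sum_le hH ?_
      rw [hdc, sum_const, nsmul_eq_mul, mul_div_cancel₀ _ hH0.ne', mul_comm, ← nsmul_eq_mul]
      exact card_nsmul_le_sum _ _ _ fun b hb => hB b (mem_filter.1 hb).1
    refine ⟨insert h U, insert_subset hhH hUH, (card_insert_le _ _).trans (by omega), ?_⟩
    have h1 : (B.filter fun b => ∀ u ∈ insert h U, ¬ rel u b) =
        B'.filter fun b => ¬ rel h b := by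
      ext b
      simp only [hB', mem_filter, mem_insert, forall_eq_or_imp]
      tauto
    have h2 := card_filter_add_card_filter_not (s := B') (rel h)
    have h2' : ((B'.filter (rel h)).card : ℝ) + ((B'.filter fun b => ¬ rel h b).card : ℝ) =
        B'.card := by exact_mod_cast h2
    have h3 : (0 : ℝ) ≤ 1 - m / H.card := by
      rw [sub_nonneg, div_le_one hH0]
      exact hmH
    rw [h1, pow_succ, ← mul_assoc]
    refine le_trans ?_ (mul_le_mul_of_nonneg_right hU h3)
    rw [mul_sub, mul_one, mul_div_assoc', mul_comm _ m]
    linarith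

/-- Double counting gives |B| ≤ |H| D / m, so about (|H| / m) log D greedy rounds leave at most |H|
/ m elements uncovered; these are covered one by one. -/
lemma exists_dominating {α β : Type*} (H : Finset α) (B : Finset β) (rel : α → β → Prop)
    [∀ a b, Decidable (rel a b)] {m D : ℝ} (hm : 0 < m) (hD : 1 ≤ D)
    (hB : ∀ b ∈ B, m ≤ (H.filter (rel · b)).card)
    (hH : ∀ h ∈ H, ((B.filter (rel h)).card : ℝ) ≤ D) :
    ∃ U ⊆ H, (U.card : ℝ) ≤ H.card / m * (Real.log D + 2) ∧ ∀ b ∈ B, ∃ u ∈ U, rel u b := by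
  classical
  have hlog : 0 ≤ Real.log D := Real.log_nonneg hD
  rcases B.eq_empty_or_nonempty with rfl | ⟨b₀, hb₀⟩
  · exact ⟨∅, empty_subset _, by simp; positivity, by simp⟩
  have hmH : m ≤ H.card := (hB b₀ hb₀).trans (by exact_mod_cast card_filter_le _ _)
  have hH0 : (0 : ℝ) < H.card := hm.trans_le hmH
  have hHne : H.Nonempty := card_pos.1 (by exact_mod_cast hH0)
  set k := ⌈H.card / m * Real.log D⌉₊ with hk
  obtain ⟨U, hUH, hUk, hU⟩ := exists_greedy H B rel hHne hmH hB k
  set B' := B.filter fun b => ∀ u ∈ U, ¬ rel u b with hB'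
  have hdc : ∑ h ∈ H, ((B.filter (rel h)).card : ℝ) =
      ∑ b ∈ B, ((H.filter (rel · b)).card : ℝ) := by
    exact_mod_cast sum_card_bipartiteAbove_eq_sum_card_bipartiteBelow rel
  have hBD : B.card * m ≤ H.card * D := by
    calc B.card * m ≤ ∑ b ∈ B, ((H.filter (rel · b)).card : ℝ) := by
          rw [← nsmul_eq_mul]; exact card_nsmul_le_sum _ _ _ hB
      _ = ∑ h ∈ H, ((B.filter (rel h)).card : ℝ) := hdc.symm
      _ ≤ H.card * D := by rw [← nsmul_eq_mul]; exact sum_le_card_nsmul _ _ _ hH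
  have hB'c : (B'.card : ℝ) ≤ H.card / m := by
    have h1 : (1 - m / H.card) ^ k ≤ D⁻¹ := by
      calc (1 - m / H.card) ^ k ≤ Real.exp (-(m / H.card)) ^ k := by
            refine pow_le_pow_left₀ ?_ (Real.one_sub_le_exp_neg _) _
            rw [sub_nonneg, div_le_one hH0]
            exact hmH
        _ = Real.exp (-(k * (m / H.card))) := by rw [← Real.exp_nat_mul]; ring_nf
        _ ≤ Real.exp (-Real.log D) := by
            refine Real.exp_le_exp.2 (neg_le_neg ?_)
            have := Nat.le_ceil (H.card / m * Real.log D)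
            calc Real.log D = H.card / m * Real.log D * (m / H.card) := by field_simp
              _ ≤ k * (m / H.card) := by gcongr
        _ = D⁻¹ := by rw [Real.exp_neg, Real.exp_log (by linarith)]
    calc (B'.card : ℝ) ≤ B.card * D⁻¹ := hU.trans (by gcongr)
      _ ≤ H.card / m := by
        rw [← div_eq_mul_inv, div_le_div_iff₀ (by linarith) hm]
        exact hBD
  have hch : ∀ b ∈ B, ∃ h ∈ H, rel h b := by
    intro b hb
    have : (0 : ℝ) < (H.filter (rel · b)).card := hm.trans_le (hB b hb)
    obtain ⟨h, hh⟩ := card_pos.1 (by exact_mod_cast this : 0 < (H.filter (rel · b)).card)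
    exact ⟨h, (mem_filter.1 hh).1, (mem_filter.1 hh).2⟩
  have : Nonempty α := ⟨hHne.choose⟩
  choose! c hcH hc using hch
  refine ⟨U ∪ B'.image c, union_subset hUH ?_, ?_, ?_⟩
  · intro x hx
    obtain ⟨b, hb, rfl⟩ := mem_image.1 hx
    exact hcH b (mem_filter.1 hb).1
  · have h1 : (U ∪ B'.image c).card ≤ k + B'.card :=
      (card_union_le _ _).trans (add_le_add hUk card_image_le)
    have h2 : (k : ℝ) < H.card / m * Real.log D + 1 := Nat.ceil_lt_add_one (by positivity)
    have h3 : 1 ≤ H.card / m := (one_le_div hm).2 hmH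
    calc ((U ∪ B'.image c).card : ℝ) ≤ k + B'.card := by exact_mod_cast h1
      _ ≤ H.card / m * Real.log D + 1 + H.card / m := by linarith
      _ ≤ _ := by linarith
  · intro b hb
    by_cases h : ∃ u ∈ U, rel u b
    · obtain ⟨u, hu, hr⟩ := h
      exact ⟨u, mem_union_left _ hu, hr⟩
    · push Not at h
      exact ⟨c b, mem_union_right _ (mem_image_of_mem _ (mem_filter.2 ⟨hb, h⟩)), hc b hb⟩

/-! ### Small separating sets -/

/-- The scale `√(log d / d)`. -/
noncomputable def scale (d : ℕ) : ℝ := Real.sqrt (Real.log d / d)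

lemma log_pos_of_two_le {d : ℕ} (hd : 2 ≤ d) : 0 < Real.log d :=
  Real.log_pos (by exact_mod_cast hd)

lemma scale_sq {d : ℕ} (hd : 2 ≤ d) : (d : ℝ) * scale d ^ 2 = Real.log d := by
  have h0 : (0 : ℝ) < d := by exact_mod_cast (by omega : 0 < d)
  rw [scale, Real.sq_sqrt (div_nonneg (log_pos_of_two_le hd).le h0.le)]
  field_simp

lemma scale_pos {d : ℕ} (hd : 2 ≤ d) : 0 < scale d :=
  Real.sqrt_pos.2 (div_pos (log_pos_of_two_le hd) (by exact_mod_cast (by omega : 0 < d)))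

lemma scale_le_one {d : ℕ} (hd : 2 ≤ d) : scale d ≤ 1 := by
  have h0 : (0 : ℝ) < d := by exact_mod_cast (by omega : 0 < d)
  rw [scale, Real.sqrt_le_one, div_le_one h0]
  exact (Real.log_le_sub_one_of_pos h0).trans (by linarith)

lemma two_thirds_le_log {d : ℕ} (hd : 2 ≤ d) : 2 / 3 ≤ Real.log d := by
  have h1 : Real.log 2 ≤ Real.log d := Real.log_le_log (by norm_num) (by exact_mod_cast hd)
  have := Real.log_two_gt_d9
  linarith

/-- A small set of vertices near the boundary whose neighbourhood meets every boundary edge. -/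
lemma exists_separating {d n : ℕ} (hd : 2 ≤ d) {S Ev : Set (Fin d → ℤ)} (hEv : IsParityClass Ev)
    (hS : IsParityRegular S Ev) (hn : (edgeBoundary (lattice d) S).encard = n) :
    ∃ U : Finset (Fin d → ℤ), (U.card : ℝ) ≤ 24 * n * scale d / d ∧
      (∀ u ∈ U, ∃ x ∈ boundaryVertices S, Near 1 u x) ∧
      ∀ v e, Crosses S v e → ∃ u ∈ U, ∃ f, v = u + step f ∨ v + step e = u + step f := by
  classical
  have hd0 : (0 : ℝ) < d := by exact_mod_cast (by omega : 0 < d)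
  have hq := scale_pos hd
  have hq1 := scale_le_one hd
  have hqs := scale_sq hd
  set q := scale d with hqdef
  -- This threshold balances |U₁| = O(n s / d²) against |U₂| = O(n log d / (d s)).
  set s : ℝ := d * q with hs
  have hs0 : 0 < s := by positivity
  have hsd : s ≤ d := mul_le_of_le_one_right hd0.le hq1
  set D := (boundaryVertices_finite hn).toFinset with hD
  have memD : ∀ v, v ∈ D ↔ v ∈ boundaryVertices S := fun v => by simp [hD]
  set R := D.filter fun v => 2 * d - s ≤ crossDegree S v with hR
  set H := D.filter fun v => s ≤ crossDegree S v with hH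
  have hRc : (R.card : ℝ) * d ≤ 2 * n :=
    card_mul_le_of_le_crossDegree hn R fun v hv => by
      have := (mem_filter.1 hv).2
      linarith
  have hHc : (H.card : ℝ) * s ≤ 2 * n :=
    card_mul_le_of_le_crossDegree hn H fun v hv => (mem_filter.1 hv).2
  let good : (Fin d → ℤ) → Finset (Fin d × Bool) := fun v =>
    univ.filter fun f => v + step f ∈ R ∧ (v + step f ∈ S ↔ v ∈ S)
  set U₁ := (R.biUnion fun v => univ.image fun f => v + step f).filter
    fun v => (d : ℝ) / 2 ≤ (good v).card with hU₁
  have hU₁c : (U₁.card : ℝ) * (d / 2) ≤ R.card * s := by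
    -- An edge from `U₁` to a good neighbour in `R` does not cross, and a vertex of `R` has at most
    -- `s` non-crossing edges.
    have h1 : ∑ v ∈ U₁, (good v).card ≤
        ∑ x ∈ R, (univ.filter fun f => ¬ Crosses S x f).card := by
      rw [← card_sigma, ← card_sigma]
      refine card_le_card_of_injOn (fun p => ⟨p.1 + step p.2, negStep p.2⟩) ?_ ?_
      · rintro ⟨v, f⟩ h
        simp only [coe_sigma, Set.mem_sigma_iff, mem_coe, mem_filter, mem_univ, true_and,
          good] at h
        simp only [coe_sigma, Set.mem_sigma_iff, mem_coe, mem_filter, mem_univ, true_and,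
          crosses_negStep]
        refine ⟨h.2.1, ?_⟩
        simp only [Crosses, h.2.2, not_true_eq_false, not_false_eq_true]
      · rintro ⟨v, f⟩ - ⟨v', f'⟩ - heq
        simp only [Sigma.mk.injEq, heq_eq_eq] at heq
        have hf : f = f' := by
          have := heq.2
          simp only [negStep, Prod.mk.injEq, Bool.not_inj_iff] at this
          exact Prod.ext this.1 this.2
        subst hf
        rw [add_right_cancel heq.1]
    have h2 : ∀ x ∈ R, ((univ.filter fun f => ¬ Crosses S x f).card : ℝ) ≤ s := by
      intro x hx
      have h3 := card_filter_add_card_filter_not (s := (univ : Finset (Fin d × Bool)))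
        (Crosses S x)
      rw [card_univ, card_steps] at h3
      have h4 := (mem_filter.1 hx).2
      have h5 : (crossDegree S x : ℝ) + ((univ.filter fun f => ¬ Crosses S x f).card : ℝ) =
          2 * d := by
        unfold crossDegree
        exact_mod_cast h3
      linarith
    calc (U₁.card : ℝ) * (d / 2) ≤ ∑ v ∈ U₁, ((good v).card : ℝ) := by
          rw [← nsmul_eq_mul]
          exact card_nsmul_le_sum _ _ _ fun v hv => (mem_filter.1 hv).2
      _ ≤ ∑ x ∈ R, ((univ.filter fun f => ¬ Crosses S x f).card : ℝ) := by exact_mod_cast h1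
      _ ≤ R.card * s := by
          rw [← nsmul_eq_mul]
          exact sum_le_card_nsmul _ _ _ h2
  set B := (H.biUnion fun v => univ.image fun f => v + step f).filter
    fun v => (d : ℝ) / 2 ≤ (univ.filter fun f => v + step f ∈ H).card with hB
  obtain ⟨U₂, hU₂H, hU₂c, hU₂⟩ := exists_dominating H B (fun h v => ∃ f, v = h + step f)
    (m := d / 2) (D := 2 * d) (by positivity)
    (by have : (2 : ℝ) ≤ d := by exact_mod_cast hd
        linarith) (by
      intro v hv
      refine (mem_filter.1 hv).2.trans ?_
      norm_cast
      refine card_le_card_of_injOn (fun f => v + step f) ?_ fun f _ f' _ h =>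
        step_injective (add_left_cancel h)
      intro f hf
      simp only [coe_filter, mem_univ, true_and, Set.mem_ofPred_eq] at hf ⊢
      exact ⟨hf, negStep f, by simp⟩) (by
      intro h _
      have : (B.filter fun v => ∃ f, v = h + step f).card ≤ 2 * d := by
        rw [← card_steps, ← card_univ]
        refine (card_le_card ?_).trans (card_image_le (f := fun f => h + step f))
        intro v hv
        obtain ⟨f, rfl⟩ := (mem_filter.1 hv).2
        exact mem_image_of_mem _ (mem_univ _)
      exact_mod_cast this)
  -- Either `v` has at least d/2 neighbours in `H` and is dominated by `U₂`, or more than d/2 of its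
  -- boundary edges lead to vertices of degree below `s`; in the latter case a same-side neighbour
  -- of `v` lies in `U₁`.
  have main : ∀ v e, Crosses S v e → d ≤ crossDegree S v →
      ∃ u ∈ U₁ ∪ U₂, ∃ f, v = u + step f := by
    intro v e hve hdeg
    have hdeg' : (d : ℝ) ≤ crossDegree S v := by exact_mod_cast hdeg
    by_cases hvB : (d : ℝ) / 2 ≤ (univ.filter fun f => v + step f ∈ H).card
    · have hne : (univ.filter fun f => v + step f ∈ H).Nonempty := by
        rw [← card_pos]
        have : (0 : ℝ) < (univ.filter fun f => v + step f ∈ H).card := by linarith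
        exact_mod_cast this
      obtain ⟨f, hf⟩ := hne
      obtain ⟨u, hu, hr⟩ := hU₂ v (mem_filter.2 ⟨mem_biUnion.2 ⟨_, (mem_filter.1 hf).2,
        mem_image.2 ⟨negStep f, mem_univ _, by simp⟩⟩, hvB⟩)
      exact ⟨u, mem_union_right _ hu, hr⟩
    push Not at hvB
    set L := univ.filter fun f => Crosses S v f ∧ v + step f ∉ H with hL
    have hLc : (crossDegree S v : ℝ) - d / 2 < L.card := by
      have : crossDegree S v ≤ L.card + (univ.filter fun f => v + step f ∈ H).card := by
        refine (card_le_card fun f hf => ?_).trans (card_union_le _ _)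
        simp only [hL, mem_union, mem_filter, mem_univ, true_and] at hf ⊢
        tauto
      have : (crossDegree S v : ℝ) ≤ L.card + (univ.filter fun f => v + step f ∈ H).card := by
        exact_mod_cast this
      linarith
    have hlow : ∀ f ∈ L, (crossDegree S (v + step f) : ℝ) < s := by
      intro f hf
      simp only [hL, hH, mem_filter, mem_univ, true_and, memD, not_and, not_le] at hf
      exact hf.2 hf.1.right_mem
    have hhigh : (2 * d - s : ℝ) ≤ crossDegree S v := by
      have : (0 : ℝ) < L.card := by linarith
      obtain ⟨f, hf⟩ := card_pos.1 (by exact_mod_cast this : 0 < L.card)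
      have h1 := hlow f hf
      have h2 := two_mul_le_crossDegree_add hEv hS (mem_filter.1 hf).2.1
      have h2' : (2 * d : ℝ) ≤ crossDegree S v + crossDegree S (v + step f) := by
        exact_mod_cast h2
      linarith
    have hgood : ∃ e', v ∈ S ↔ v + step e' ∈ S := by
      by_cases hv : v ∈ S
      · obtain ⟨e', he'⟩ := hS.mem_neighbor v hv
        exact ⟨e', by simp [hv, he']⟩
      · obtain ⟨e', he'⟩ := hS.notMem_neighbor v hv
        exact ⟨e', by simp [hv, he']⟩
    obtain ⟨e', he'⟩ := hgood
    -- The translate by `step f` of the edge from `v` to `v + step e'` crosses the boundary. Its end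
    -- `v + step f` has degree below `s`, so its other end has degree above 2d - s and lies in `R`.
    have hsub : L ⊆ good (v + step e') := by
      intro f hf
      have hfc := (mem_filter.1 hf).2.1
      have hcm := add_right_comm v (step e') (step f)
      have hside : v + step e' + step f ∈ S ↔ v + step e' ∈ S :=
        hve.neighbor_side hEv hS he' f
      have hc2 : Crosses S (v + step f) e' := by
        rw [hcm] at hside
        unfold Crosses at hfc ⊢
        rw [hside, ← he']
        exact fun h => hfc h.symm
      have h2 := two_mul_le_crossDegree_add hEv hS hc2
      have h2' : (2 * d : ℝ) ≤
          crossDegree S (v + step f) + crossDegree S (v + step f + step e') := by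
        exact_mod_cast h2
      have h3 := hlow f hf
      simp only [good, mem_filter, mem_univ, true_and, hR, memD]
      refine ⟨⟨?_, ?_⟩, hside⟩
      · rw [hcm]; exact hc2.right_mem
      · rw [hcm]; linarith
    have hgc : (d : ℝ) / 2 ≤ (good (v + step e')).card := by
      have : (L.card : ℝ) ≤ (good (v + step e')).card := by exact_mod_cast card_le_card hsub
      linarith
    refine ⟨v + step e', mem_union_left _ (mem_filter.2 ⟨?_, hgc⟩), negStep e', by simp⟩
    have : (0 : ℝ) < (good (v + step e')).card := by linarith
    obtain ⟨f, hf⟩ := card_pos.1 (by exact_mod_cast this : 0 < (good (v + step e')).card)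
    refine mem_biUnion.2 ⟨_, (mem_filter.1 hf).2.1, mem_image.2 ⟨negStep f, mem_univ _, ?_⟩⟩
    simp
  refine ⟨U₁ ∪ U₂, ?_, ?_, ?_⟩
  · have h1 : ((U₁ ∪ U₂).card : ℝ) ≤ U₁.card + U₂.card := by exact_mod_cast card_union_le _ _
    have h2 : (U₁.card : ℝ) ≤ 4 * n * q / d := by
      rw [le_div_iff₀ hd0]
      have h3 : (R.card : ℝ) * s ≤ 2 * n * q := by
        calc (R.card : ℝ) * s = R.card * d * q := by rw [hs]; ring
          _ ≤ 2 * n * q := by gcongr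
      linarith
    have h4 : (U₂.card : ℝ) ≤ 20 * n * q / d := by
      -- Here log 2 ≤ log d and 2 ≤ 3 log d.
      have h5 : Real.log (2 * d) + 2 ≤ 5 * (d * q ^ 2) := by
        rw [hqs, Real.log_mul (by norm_num) hd0.ne']
        have := two_thirds_le_log hd
        have : Real.log 2 ≤ Real.log d :=
          Real.log_le_log (by norm_num) (by exact_mod_cast hd)
        linarith
      calc (U₂.card : ℝ) ≤ H.card / (d / 2) * (5 * (d * q ^ 2)) := hU₂c.trans (by gcongr)
        _ = 10 * (H.card * s) * q / d := by rw [hs]; field_simp; ring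
        _ ≤ 10 * (2 * n) * q / d := by gcongr
        _ = _ := by ring
    calc _ ≤ _ := h1
      _ ≤ 4 * n * q / d + 20 * n * q / d := add_le_add h2 h4
      _ = _ := by ring
  · intro u hu
    rcases mem_union.1 hu with hu | hu
    · obtain ⟨x, hx, hux⟩ := mem_biUnion.1 (mem_filter.1 hu).1
      obtain ⟨f, -, rfl⟩ := mem_image.1 hux
      exact ⟨x, (memD x).1 (mem_filter.1 hx).1, (near_step x f).symm⟩
    · exact ⟨u, (memD u).1 (mem_filter.1 (hU₂H hu)).1, near_refl _ _⟩
  · intro v e hve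
    have h2 := two_mul_le_crossDegree_add hEv hS hve
    by_cases hdeg : d ≤ crossDegree S v
    · obtain ⟨u, hu, f, hf⟩ := main v e hve hdeg
      exact ⟨u, hu, f, Or.inl hf⟩
    · obtain ⟨u, hu, f, hf⟩ := main (v + step e) (negStep e) (crosses_negStep.2 hve) (by omega)
      exact ⟨u, hu, f, Or.inr hf⟩


/-! ### Counting connected sets by walks -/

section Walks

variable {α : Type*} [DecidableEq α]

/-- The sets of vertices visited by the walks of length `m` from `u`, where `nb x` lists the
possible successors of `x`. -/
def walkSets (nb : α → Finset α) : ℕ → α → Finset (Finset α)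
  | 0, u => {{u}}
  | m + 1, u => (nb u).biUnion fun v => (walkSets nb m v).image (insert u)

lemma mem_walkSets_succ {nb : α → Finset α} {m : ℕ} {u : α} {T : Finset α} :
    T ∈ walkSets nb (m + 1) u ↔ ∃ v ∈ nb u, ∃ T' ∈ walkSets nb m v, insert u T' = T := by
  simp [walkSets]

lemma card_walkSets_le {nb : α → Finset α} {Δ : ℕ} (hnb : ∀ u, (nb u).card ≤ Δ) (m : ℕ) (u : α) :
    (walkSets nb m u).card ≤ Δ ^ m := by
  induction m generalizing u with
  | zero => simp [walkSets]
  | succ m ih =>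
    rw [walkSets, pow_succ']
    exact (card_biUnion_le_card_mul _ _ (Δ ^ m) fun v _ => card_image_le.trans (ih v)).trans
      (Nat.mul_le_mul_right _ (hnb u))

lemma start_mem_of_mem_walkSets {nb : α → Finset α} {m : ℕ} {u : α} {T : Finset α}
    (h : T ∈ walkSets nb m u) : u ∈ T := by
  cases m with
  | zero => simp_all [walkSets]
  | succ m =>
    obtain ⟨v, -, T', -, rfl⟩ := mem_walkSets_succ.1 h
    exact mem_insert_self _ _

lemma walkSets_mono {nb : α → Finset α} (hnb : ∀ u, u ∈ nb u) {m m' : ℕ} (hm : m ≤ m') {u : α} :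
    walkSets nb m u ⊆ walkSets nb m' u := by
  induction hm with
  | refl => exact Subset.rfl
  | step _ ih =>
    refine ih.trans fun T hT => mem_walkSets_succ.2 ⟨u, hnb u, T, hT, ?_⟩
    exact insert_eq_self.2 (start_mem_of_mem_walkSets hT)

/-- At a visit to `x`, insert the detour from `x` to `y` and back. -/
lemma insert_mem_walkSets {nb : α → Finset α} {m : ℕ} {u x y : α} {T : Finset α}
    (hT : T ∈ walkSets nb m u) (hx : x ∈ T) (hxy : y ∈ nb x) (hyx : x ∈ nb y) :
    insert y T ∈ walkSets nb (m + 2) u := by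
  have detour : ∀ m, ∀ T ∈ walkSets nb m x, insert y T ∈ walkSets nb (m + 2) x := fun m T hT =>
    mem_walkSets_succ.2 ⟨y, hxy, insert y T, mem_walkSets_succ.2 ⟨x, hyx, T, hT, rfl⟩,
      insert_eq_self.2 (mem_insert_of_mem (start_mem_of_mem_walkSets hT))⟩
  induction m generalizing u T with
  | zero =>
    have : x = u := by simp_all [walkSets]
    exact this ▸ detour 0 T (this ▸ hT)
  | succ m ih =>
    by_cases hxu : x = u
    · exact hxu ▸ detour _ T (hxu ▸ hT)
    obtain ⟨v, hv, T', hT', rfl⟩ := mem_walkSets_succ.1 hT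
    have hx' : x ∈ T' := (mem_insert.1 hx).resolve_left hxu
    exact mem_walkSets_succ.2 ⟨v, hv, _, ih hT' hx', Finset.insert_comm _ _ _⟩

/-- Grow the visited set one vertex at a time, each costing a detour of length 2. Since `nb` is
reflexive, the walk may stand still to reach length exactly `2 * K`. -/
lemma mem_walkSets_of_connected {nb : α → Finset α} (hnb : ∀ u, u ∈ nb u)
    (hsymm : ∀ u v, u ∈ nb v → v ∈ nb u) {U : Finset α}
    (hU : ∀ T ⊆ U, T.Nonempty → (∀ x ∈ T, ∀ y ∈ U, y ∈ nb x → y ∈ T) → T = U) {u : α}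
    (hu : u ∈ U) {K : ℕ} (hK : U.card ≤ K) : U ∈ walkSets nb (2 * K) u := by
  have key : ∀ k < U.card, ∃ T ⊆ U, T.card = k + 1 ∧ T ∈ walkSets nb (2 * k) u := by
    intro k
    induction k with
    | zero => exact fun _ => ⟨{u}, by simpa using hu, rfl, by simp [walkSets]⟩
    | succ k ih =>
      intro hk
      obtain ⟨T, hTU, hTc, hT⟩ := ih (by omega)
      have hne : T ≠ U := by rintro rfl; omega
      have hnot : ¬ ∀ x ∈ T, ∀ y ∈ U, y ∈ nb x → y ∈ T := fun h =>
        hne (hU T hTU ⟨u, start_mem_of_mem_walkSets hT⟩ h)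
      push Not at hnot
      obtain ⟨x, hx, y, hy, hyx, hyT⟩ := hnot
      exact ⟨insert y T, insert_subset hy hTU, by rw [card_insert_of_notMem hyT, hTc],
        insert_mem_walkSets hT hx hyx (hsymm _ _ hyx)⟩
  have hpos : 0 < U.card := card_pos.2 ⟨u, hu⟩
  obtain ⟨T, hTU, hTc, hT⟩ := key (U.card - 1) (by omega)
  have : T = U := eq_of_subset_of_card_le hTU (by omega)
  exact this ▸ walkSets_mono hnb (by omega) hT

end Walks

/-! ### Counting separating sets -/

/-- Each boundary edge of `S` has an endpoint adjacent to `U`. -/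
def Separates {d : ℕ} (U : Finset (Fin d → ℤ)) (S : Set (Fin d → ℤ)) : Prop :=
  ∀ v e, Crosses S v e → ∃ u ∈ U, ∃ f, v = u + step f ∨ v + step e = u + step f

lemma Separates.exists_near {d : ℕ} {U : Finset (Fin d → ℤ)} {S : Set (Fin d → ℤ)}
    (h : Separates U S) {x : Fin d → ℤ} (hx : x ∈ boundaryVertices S) : ∃ u ∈ U, Near 2 x u := by
  obtain ⟨e, he⟩ := hx
  obtain ⟨u, hu, f, hf | hf⟩ := h x e he
  · exact ⟨u, hu, hf ▸ (near_step u f).symm.mono (by omega)⟩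
  · exact ⟨u, hu, (near_step x e).trans (hf ▸ (near_step u f).symm)⟩

/-- Boundary connectivity is applied to the boundary vertices within 2 of `T`. The scale is r + 5 =
2 + (r + 1) + 2: from `T` to the boundary, one jump along it, and back to `U`. -/
lemma IsCutset.separating_connected {d r : ℕ} (hr : 1 ≤ r) {S : Set (Fin d → ℤ)}
    (hS : IsCutset r S) {U : Finset (Fin d → ℤ)} (hU : Separates U S)
    (hUD : ∀ u ∈ U, ∃ x ∈ boundaryVertices S, Near 1 u x) (T : Finset (Fin d → ℤ)) (hTU : T ⊆ U)
    (hT : T.Nonempty) (hcl : ∀ x ∈ T, ∀ y ∈ U, Near (r + 5) x y → y ∈ T) : T = U := by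
  have hP : {x | x ∈ boundaryVertices S ∧ ∃ u ∈ T, Near 2 x u} = boundaryVertices S := by
    refine hS.boundary_connected hr ?_ (fun x hx => hx.1) ?_
    · obtain ⟨u, hu⟩ := hT
      obtain ⟨x, hx, hux⟩ := hUD u (hTU hu)
      obtain ⟨u', hu', hxu'⟩ := hU.exists_near hx
      exact ⟨x, hx, u', hcl u hu u' hu' ((hux.trans hxu').mono (by omega)), hxu'⟩
    · rintro x ⟨hx, u, hu, hxu⟩ y hy hxy
      obtain ⟨u', hu', hyu'⟩ := hU.exists_near hy
      exact ⟨hy, u', hcl u hu u' hu' (((hxu.symm.trans hxy).trans hyu').mono (by omega)), hyu'⟩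
  refine hTU.antisymm fun u' hu' => ?_
  obtain ⟨x, hx, hux⟩ := hUD u' hu'
  rw [← hP] at hx
  obtain ⟨-, u, hu, hxu⟩ := hx
  exact hcl u hu u' hu' ((hxu.symm.trans hux.symm).mono (by omega))

lemma exists_exit {d : ℕ} {S : Set (Fin d → ℤ)} (hS : S.Finite) {v : Fin d → ℤ} (hv : v ∈ S)
    (e : Fin d × Bool) :
    ∃ m : ℕ, (∀ i ≤ m, v + i • step e ∈ S) ∧ Crosses S (v + m • step e) e := by
  classical
  have hex : ∃ m : ℕ, v + m • step e ∉ S := by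
    by_contra h
    push Not at h
    refine Set.infinite_of_injective_forall_mem (f := fun m : ℕ => v + m • step e) ?_ h hS
    intro m m' hmm
    have := congrFun (add_left_cancel hmm) e.1
    rcases e with ⟨i, b⟩
    cases b <;> simpa [step] using this
  set m := Nat.find hex with hm
  have h0 : m ≠ 0 := by
    intro h
    have := Nat.find_spec hex
    rw [← hm, h, zero_smul, add_zero] at this
    exact this hv
  have hlt : ∀ i ≤ m - 1, v + i • step e ∈ S := fun i hi =>
    not_not.1 (Nat.find_min hex (m := i) (by omega))
  refine ⟨m - 1, hlt, ?_⟩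
  have h1 : v + (m - 1) • step e + step e = v + m • step e := by
    rw [add_assoc, ← succ_nsmul, Nat.sub_add_cancel (by omega)]
  have h2 := hlt (m - 1) le_rfl
  have h3 := Nat.find_spec hex
  unfold Crosses
  rw [h1]
  tauto

/-- Until the ray exits, each of its points lies in `S` and sends a perpendicular ray that ends at
its own boundary vertex; there are at most 2n boundary vertices. -/
lemma exists_boundary_on_ray {d n : ℕ} {S : Set (Fin d → ℤ)} (hS : S.Finite)
    (hn : (edgeBoundary (lattice d) S).encard = n) {i j : Fin d} (hij : i ≠ j)
    {v : Fin d → ℤ} (hv : v ∈ S) :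
    ∃ m < 2 * n, v + m • step (i, true) ∈ boundaryVertices S := by
  classical
  obtain ⟨m, hm, hc⟩ := exists_exit hS hv (i, true)
  refine ⟨m, ?_, hc.left_mem⟩
  have hex : ∀ k ≤ m, ∃ l : ℕ,
      v + k • step (i, true) + l • step (j, true) ∈ boundaryVertices S := fun k hk => by
    obtain ⟨l, -, hl⟩ := exists_exit hS (hm k hk) (j, true)
    exact ⟨l, hl.left_mem⟩
  choose! l hl using hex
  let g : ℕ → Fin d → ℤ := fun k => v + k • step (i, true) + l k • step (j, true)
  have hinj : Function.Injective g := by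
    intro k k' h
    have := congrFun h i
    simpa [g, step, hij] using this
  have := card_mul_le_of_le_crossDegree hn ((range (m + 1)).image g) (m := 1) fun x hx => by
    obtain ⟨k, hk, rfl⟩ := mem_image.1 hx
    obtain ⟨e, he⟩ := hl k (by simpa [Nat.lt_succ_iff] using hk)
    have : 0 < crossDegree S (g k) := card_pos.2 ⟨e, mem_filter.2 ⟨mem_univ _, he⟩⟩
    exact_mod_cast this
  rw [card_image_of_injective _ hinj, card_range, mul_one] at this
  have : m + 1 ≤ 2 * n := by exact_mod_cast this
  omega

/-- The maximal size of the separating sets. -/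
noncomputable def sepSize (d n : ℕ) : ℕ := ⌊24 * n * scale d / d⌋₊

/-- All odd cutsets are separated by members of a small family of small sets. -/
lemma exists_separating_family {d : ℕ} (hd : 2 ≤ d) (n : ℕ) {r : ℕ} (hr : 1 ≤ r) :
    ∃ 𝒰 : Finset (Finset (Fin d → ℤ)),
      𝒰.card ≤ (2 * d + 1) ^ r * (2 * n) * (2 * d + 1) ^ 2 *
        ((2 * d + 1) ^ (r + 5)) ^ (2 * sepSize d n) ∧
      ∀ S ∈ oddCutsets d n r, ∃ U ∈ 𝒰, U.Nonempty ∧ U.card ≤ sepSize d n ∧ Separates U S := by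
  classical
  let i : Fin d := ⟨0, by omega⟩
  let j : Fin d := ⟨1, by omega⟩
  have hij : i ≠ j := by simp [i, j]
  let nb : (Fin d → ℤ) → Finset (Fin d → ℤ) := fun u => (ball (r + 5) u).filter (Near (r + 5) u)
  have hnb : ∀ u v, v ∈ nb u ↔ Near (r + 5) u v := fun u v => by
    simp only [nb, mem_filter, and_iff_right_iff_imp]
    exact mem_ball
  -- A point of `S` within `r` of the origin, at most 2n - 1 steps along a ray to the boundary, then
  -- a point of `U` within 2.
  let roots : Finset (Fin d → ℤ) := ((ball r 0).biUnion fun s =>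
    (range (2 * n)).image fun m => s + m • step (i, true)).biUnion (ball 2)
  have hroots : roots.card ≤ (2 * d + 1) ^ r * (2 * n) * (2 * d + 1) ^ 2 := by
    refine (card_biUnion_le_card_mul _ _ _ fun v _ => card_ball_le 2 v).trans
      (Nat.mul_le_mul_right _ ?_)
    refine (card_biUnion_le_card_mul _ _ (2 * n) fun s _ => ?_).trans
      (Nat.mul_le_mul_right _ (card_ball_le r 0))
    exact card_image_le.trans (card_range _).le
  refine ⟨roots.biUnion (walkSets nb (2 * sepSize d n)), ?_, ?_⟩
  · refine (card_biUnion_le_card_mul _ _ _ fun u _ => card_walkSets_le (fun v => ?_) _ u).trans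
      (Nat.mul_le_mul_right _ hroots)
    exact (card_filter_le _ _).trans (card_ball_le _ v)
  · rintro S ⟨hcut, hodd, hn, s, hs, hsr⟩
    have hreg := isParityRegular_of_isOddSet hcut.regular hodd
    obtain ⟨U, hUc, hUD, hU⟩ := exists_separating hd (isParityClass_evenVertices d) hreg hn
    have hUK : U.card ≤ sepSize d n := Nat.le_floor hUc
    obtain ⟨m, hm, hmD⟩ := exists_boundary_on_ray hcut.finite hn hij hs
    obtain ⟨u, hu, hmu⟩ := Separates.exists_near hU hmD
    refine ⟨U, mem_biUnion.2 ⟨u, ?_, ?_⟩, ⟨u, hu⟩, hUK, hU⟩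
    · exact mem_biUnion.2 ⟨_, mem_biUnion.2 ⟨s, mem_ball hsr,
        mem_image_of_mem _ (mem_range.2 hm)⟩, mem_ball hmu⟩
    · refine mem_walkSets_of_connected (fun v => (hnb v v).2 (near_refl _ _))
        (fun x y h => (hnb x y).2 ((hnb y x).1 h).symm) ?_ hu hUK
      intro T hTU hT hcl
      exact hcut.separating_connected hr hU hUD T hTU hT
        fun x hx y hy hxy => hcl x hx y hy ((hnb x y).2 hxy)


/-! ### Components off the neighbourhood of a separating set -/

open Classical in
/-- The neighbourhood of a finite set. -/
noncomputable def nbhd {d : ℕ} (U : Finset (Fin d → ℤ)) : Finset (Fin d → ℤ) :=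
  U.biUnion fun u => univ.image fun e => u + step e

lemma mem_nbhd {d : ℕ} {U : Finset (Fin d → ℤ)} {v : Fin d → ℤ} :
    v ∈ nbhd U ↔ ∃ u ∈ U, ∃ e, v = u + step e := by
  simp [nbhd, eq_comm]

lemma card_nbhd_le {d : ℕ} (U : Finset (Fin d → ℤ)) : (nbhd U).card ≤ U.card * (2 * d) := by
  classical
  refine card_biUnion_le_card_mul _ _ _ fun u _ => card_image_le.trans ?_
  rw [card_univ, card_steps]

/-- The vertices reachable from `x` by lattice paths avoiding `W`. -/
def component {d : ℕ} (W : Finset (Fin d → ℤ)) (x : Fin d → ℤ) : Set (Fin d → ℤ) :=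
  {y | Relation.ReflTransGen (fun a b => b ∉ W ∧ ∃ e, b = a + step e) x y}

lemma self_mem_component {d : ℕ} (W : Finset (Fin d → ℤ)) (x : Fin d → ℤ) : x ∈ component W x :=
  Relation.ReflTransGen.refl

lemma step_mem_component {d : ℕ} {W : Finset (Fin d → ℤ)} {x y : Fin d → ℤ}
    (hy : y ∈ component W x) {e : Fin d × Bool} (h : y + step e ∉ W) :
    y + step e ∈ component W x :=
  Relation.ReflTransGen.tail hy ⟨h, e, rfl⟩

lemma notMem_of_mem_component {d : ℕ} {W : Finset (Fin d → ℤ)} {x y : Fin d → ℤ} (hx : x ∉ W)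
    (hy : y ∈ component W x) : y ∉ W := by
  cases hy with
  | refl => exact hx
  | tail _ h => exact h.1

lemma component_eq {d : ℕ} {W : Finset (Fin d → ℤ)} {x y : Fin d → ℤ} (hx : x ∉ W)
    (hy : y ∈ component W x) : component W y = component W x := by
  have hyx : x ∈ component W y := by
    induction hy with
    | refl => exact self_mem_component W x
    | @tail b c hb hbc ih =>
      obtain ⟨hc, e, rfl⟩ := hbc
      refine Relation.ReflTransGen.head ⟨notMem_of_mem_component hx hb, negStep e, ?_⟩ ih
      simp
  ext z
  exact ⟨fun h => Relation.ReflTransGen.trans hy h, fun h => Relation.ReflTransGen.trans hyx h⟩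

/-- The vertices outside `W` whose component has fewer than `d` vertices. -/
def smallVertices {d : ℕ} (W : Finset (Fin d → ℤ)) : Set (Fin d → ℤ) :=
  {x | x ∉ W ∧ (component W x).encard < d}

/-- Neighbours outside `W` lie in the same component, so a vertex of a small component has at least
`d` of its 2d neighbours in `W`. Count these edges from `W`. -/
lemma card_smallVertices_le {d : ℕ} (hd : 0 < d) (W X : Finset (Fin d → ℤ))
    (hX : (X : Set (Fin d → ℤ)) ⊆ smallVertices W) : X.card ≤ 2 * W.card := by
  classical
  have h1 : ∀ x ∈ X, d ≤ (univ.filter fun e => x + step e ∈ W).card := by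
    intro x hx
    obtain ⟨hxW, hxc⟩ := hX hx
    have hfin : (component W x).Finite := Set.finite_of_encard_le_coe hxc.le
    have h2 : (univ.filter fun e => x + step e ∉ W).card ≤ hfin.toFinset.card := by
      refine card_le_card_of_injOn (fun e => x + step e) ?_ fun e _ e' _ h =>
        step_injective (add_left_cancel h)
      intro e he
      simp only [coe_filter, mem_univ, true_and, Set.mem_ofPred_eq] at he
      simpa using step_mem_component (self_mem_component W x) he
    rw [hfin.encard_eq_coe_toFinset_card] at hxc
    have h3 : hfin.toFinset.card < d := by exact_mod_cast hxc
    have h4 := card_filter_add_card_filter_not (s := (univ : Finset (Fin d × Bool)))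
      fun e => x + step e ∈ W
    rw [card_univ, card_steps] at h4
    omega
  have h2 : ∑ x ∈ X, (univ.filter fun e => x + step e ∈ W).card ≤
      (W ×ˢ (univ : Finset (Fin d × Bool))).card := by
    rw [← card_sigma]
    refine card_le_card_of_injOn
      (fun p => ((p.1 + step p.2, p.2) : (Fin d → ℤ) × (Fin d × Bool))) ?_ ?_
    · rintro ⟨x, e⟩ h
      simp only [coe_sigma, Set.mem_sigma_iff, mem_coe, mem_filter, mem_univ, true_and] at h
      simp [h.2]
    · rintro ⟨x, e⟩ - ⟨x', e'⟩ - heq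
      simp only [Prod.mk.injEq] at heq
      obtain ⟨h, rfl⟩ := heq
      rw [add_right_cancel h]
  rw [card_product, card_univ, card_steps] at h2
  have h3 := card_nsmul_le_sum X _ d h1
  rw [smul_eq_mul] at h3
  have h4 : X.card * d ≤ 2 * W.card * d := by nlinarith
  exact Nat.le_of_mul_le_mul_right h4 hd

lemma smallVertices_finite {d : ℕ} (hd : 0 < d) (W : Finset (Fin d → ℤ)) :
    (smallVertices W).Finite := by
  by_contra h
  obtain ⟨X, hX, hXc⟩ := Set.Infinite.exists_subset_card_eq h (2 * W.card + 1)
  have := card_smallVertices_le hd W X hX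
  omega

open Classical in
/-- `W` together with its small components. -/
noncomputable def fill {d : ℕ} (hd : 0 < d) (W : Finset (Fin d → ℤ)) : Finset (Fin d → ℤ) :=
  W ∪ (smallVertices_finite hd W).toFinset

lemma card_fill_le {d : ℕ} (hd : 0 < d) (W : Finset (Fin d → ℤ)) :
    (fill hd W).card ≤ 3 * W.card := by
  classical
  have := card_smallVertices_le hd W (smallVertices_finite hd W).toFinset (by simp)
  exact (card_union_le _ _).trans (by omega)

lemma mem_fill {d : ℕ} {hd : 0 < d} {W : Finset (Fin d → ℤ)} {x : Fin d → ℤ} :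
    x ∈ fill hd W ↔ x ∈ W ∨ (component W x).encard < d := by
  simp only [fill, mem_union, Set.Finite.mem_toFinset, smallVertices, Set.mem_ofPred_eq]
  tauto

open Classical in
/-- The axis-parallel lines meeting `B`. -/
noncomputable def axisLines {d : ℕ} (B : Finset (Fin d → ℤ)) : Finset (Fin d × (Fin d → ℤ)) :=
  (B ×ˢ univ).image fun p => (p.2, Function.update p.1 p.2 0)

/-- Two distinct points share at most one axis-parallel line, so a new point adds `d` lines of which
at most |B| are old. -/
lemma le_card_axisLines {d : ℕ} (B : Finset (Fin d → ℤ)) :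
    B.card * d ≤ (axisLines B).card + B.card.choose 2 := by
  classical
  induction B using Finset.induction_on with
  | empty => simp
  | insert x B hx ih =>
    let newLines : Finset (Fin d × (Fin d → ℤ)) := univ.image fun i => (i, Function.update x i 0)
    have h1 : axisLines (insert x B) = axisLines B ∪ newLines := by
      ext ⟨i, z⟩
      simp only [axisLines, newLines, mem_image, mem_union, mem_product, mem_insert, mem_univ,
        and_true, Prod.exists, Prod.mk.injEq, true_and]
      constructor
      · rintro ⟨y, j, rfl | hy, rfl, rfl⟩
        · exact Or.inr ⟨_, rfl, rfl⟩
        · exact Or.inl ⟨y, _, hy, rfl, rfl⟩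
      · rintro (⟨y, j, hy, rfl, rfl⟩ | ⟨j, rfl, rfl⟩)
        · exact ⟨y, _, Or.inr hy, rfl, rfl⟩
        · exact ⟨x, _, Or.inl rfl, rfl, rfl⟩
    have h2 : newLines.card = d := by
      rw [card_image_of_injective _ fun i j h => (Prod.mk.inj h).1, card_univ, Fintype.card_fin]
    have h3 : (axisLines B ∩ newLines).card ≤ B.card := by
      have hex : ∀ l ∈ axisLines B ∩ newLines, ∃ y ∈ B,
          l = (l.1, Function.update y l.1 0) ∧ l = (l.1, Function.update x l.1 0) := by
        rintro ⟨i, z⟩ hl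
        obtain ⟨h4, h5⟩ := mem_inter.1 hl
        simp only [axisLines, newLines, mem_image, mem_product, mem_univ, and_true, true_and,
          Prod.exists, Prod.mk.injEq] at h4 h5
        obtain ⟨y, j, hy, rfl, rfl⟩ := h4
        obtain ⟨k, rfl, h6⟩ := h5
        exact ⟨y, hy, rfl, by rw [h6]⟩
      choose! c hcB hc using hex
      refine card_le_card_of_injOn c hcB ?_
      intro l hl l' hl' hcc
      obtain ⟨h5, h6⟩ := hc l hl
      obtain ⟨h5', h6'⟩ := hc l' hl'
      have h7 : Function.update (c l) l.1 0 = Function.update x l.1 0 :=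
        congrArg Prod.snd (h5.symm.trans h6)
      have h8 : Function.update (c l) l'.1 0 = Function.update x l'.1 0 := by
        rw [hcc]
        exact congrArg Prod.snd (h5'.symm.trans h6')
      have h9 : l.1 = l'.1 := by
        by_contra hne
        refine hx ?_
        have : c l = x := by
          ext k
          by_cases hk : k = l.1
          · have := congrFun h8 k
            rwa [Function.update_of_ne (by rw [hk]; exact hne),
              Function.update_of_ne (by rw [hk]; exact hne)] at this
          · have := congrFun h7 k
            rwa [Function.update_of_ne hk, Function.update_of_ne hk] at this
        exact this ▸ hcB l hl
      rw [h6, h6', h9]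
    have h4 := card_union_add_card_inter (axisLines B) newLines
    have h5 : (B.card + 1).choose 2 = B.card + B.card.choose 2 := by
      rw [Nat.choose_succ_succ', Nat.choose_one_right]
    rw [card_insert_of_notMem hx, h1, h5, add_mul, one_mul]
    omega

/-- The finite components with at least `d` vertices. -/
def largeComponents {d : ℕ} (W : Finset (Fin d → ℤ)) : Set (Set (Fin d → ℤ)) :=
  {C | C.Finite ∧ d ≤ C.ncard ∧ ∃ x ∉ W, C = component W x}

/-- Any `d` points of `C` meet at least d² - d(d - 1)/2 = d(d + 1)/2 axis lines, and on each of them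
the finite set `C` is left in the positive direction, into `W`. -/
lemma le_card_exits {d : ℕ} {W : Finset (Fin d → ℤ)} {C : Set (Fin d → ℤ)}
    (hC : C ∈ largeComponents W) {X : Finset ((Fin d → ℤ) × Fin d)}
    (hX : ∀ p, p ∈ X ↔ p.1 ∈ C ∧ p.1 + step (p.2, true) ∈ W) :
    d * (d + 1) ≤ 2 * X.card := by
  classical
  obtain ⟨hfin, hcard, x, hx, hCx⟩ := hC
  rw [Set.ncard_eq_toFinset_card _ hfin] at hcard
  obtain ⟨B, hBC, hB⟩ := exists_subset_card_eq hcard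
  have hle : (axisLines B).card ≤ X.card := by
    refine (card_le_card ?_).trans (card_image_le (f := fun p : (Fin d → ℤ) × Fin d =>
      (p.2, Function.update p.1 p.2 0)))
    intro l hl
    obtain ⟨⟨y, i⟩, hy, rfl⟩ := mem_image.1 hl
    have hyC : y ∈ C := by simpa using hBC (mem_product.1 hy).1
    obtain ⟨m, hm, hc⟩ := exists_exit hfin hyC (i, true)
    refine mem_image.2 ⟨(y + m • step (i, true), i), (hX _).2 ⟨hm m le_rfl, ?_⟩, ?_⟩
    · by_contra h
      have h1 : y + m • step (i, true) + step (i, true) ∈ C := by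
        rw [hCx]
        exact step_mem_component (hCx ▸ hm m le_rfl) h
      exact hc ⟨fun _ => h1, fun _ => hm m le_rfl⟩
    · simp only [Prod.mk.injEq, true_and]
      ext k
      by_cases hk : k = i
      · subst hk; simp
      · simp [hk, step]
  have h1 := le_card_axisLines B
  rw [hB] at h1
  have h2 := Nat.choose_two_right d
  have h3 : d * (d - 1) / 2 * 2 ≤ d * (d - 1) := Nat.div_mul_le_self _ _
  rw [h2] at h1
  rcases d with _ | d
  · simp
  · rw [Nat.add_sub_cancel] at *
    nlinarith

/-- A point of `W` and a direction determine the exit, hence the component; so the exits of all the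
components number at most d |W|. -/
lemma card_largeComponents_le {d : ℕ} (hd : 0 < d) (W : Finset (Fin d → ℤ))
    (L : Finset (Set (Fin d → ℤ))) (hL : (L : Set (Set (Fin d → ℤ))) ⊆ largeComponents W) :
    L.card * (d + 1) ≤ 2 * W.card := by
  classical
  have hex : ∀ C ∈ L, ∃ X : Finset ((Fin d → ℤ) × Fin d),
      ∀ p, p ∈ X ↔ p.1 ∈ C ∧ p.1 + step (p.2, true) ∈ W := by
    intro C hC
    have hfin := (hL hC).1
    refine ⟨(hfin.toFinset ×ˢ univ).filter fun p => p.1 + step (p.2, true) ∈ W, fun p => ?_⟩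
    simp
  choose! X hX using hex
  have h1 : ∀ C ∈ L, d * (d + 1) ≤ 2 * (X C).card := fun C hC =>
    le_card_exits (hL hC) (hX C hC)
  have h2 : ∑ C ∈ L, (X C).card ≤ (W ×ˢ (univ : Finset (Fin d))).card := by
    rw [← card_sigma]
    refine card_le_card_of_injOn (fun p => (p.2.1 + step (p.2.2, true), p.2.2)) ?_ ?_
    · rintro ⟨C, p⟩ h
      simp only [coe_sigma, Set.mem_sigma_iff, mem_coe] at h
      simpa using ((hX C h.1 p).1 h.2).2
    · rintro ⟨C, p, i⟩ h ⟨C', p', i'⟩ h' heq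
      simp only [Prod.mk.injEq] at heq
      obtain ⟨h3, rfl⟩ := heq
      obtain rfl := add_right_cancel h3
      simp only [coe_sigma, Set.mem_sigma_iff, mem_coe] at h h'
      have hpC := ((hX C h.1 _).1 h.2).1
      have hpC' := ((hX C' h'.1 _).1 h'.2).1
      obtain ⟨-, -, x, hx, rfl⟩ := hL h.1
      obtain ⟨-, -, x', hx', rfl⟩ := hL h'.1
      rw [← component_eq hx hpC, ← component_eq hx' hpC']
  have h3 : ∑ C ∈ L, d * (d + 1) ≤ ∑ C ∈ L, 2 * (X C).card := sum_le_sum h1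
  rw [sum_const, smul_eq_mul, ← mul_sum] at h3
  rw [card_product, card_univ, Fintype.card_fin] at h2
  refine Nat.le_of_mul_le_mul_right (c := d) ?_ hd
  nlinarith

lemma largeComponents_finite {d : ℕ} (hd : 0 < d) (W : Finset (Fin d → ℤ)) :
    (largeComponents W).Finite := by
  by_contra h
  obtain ⟨L, hL, hLc⟩ := Set.Infinite.exists_subset_card_eq h (2 * W.card + 1)
  have := card_largeComponents_le hd W L hL
  rw [hLc] at this
  nlinarith

/-- Given a separating set `U`, the trace of `S` outside the filled neighbourhood of `U` belongs to
a family of at most `16 ^ |U|` sets. -/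
lemma exists_trace_family {d : ℕ} (hd : 0 < d) (U : Finset (Fin d → ℤ)) :
    ∃ 𝒯 : Finset (Set (Fin d → ℤ)), 𝒯.card ≤ 2 ^ (4 * U.card) ∧
      ∀ S : Set (Fin d → ℤ), S.Finite → Separates U S → S \ fill hd (nbhd U) ∈ 𝒯 := by
  classical
  set W := nbhd U with hW
  set L := (largeComponents_finite hd W).toFinset with hL
  refine ⟨L.powerset.image fun Q => ⋃ C ∈ Q, C, ?_, ?_⟩
  · refine card_image_le.trans ?_
    rw [card_powerset]
    refine Nat.pow_le_pow_right (by norm_num) ?_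
    have h1 := card_largeComponents_le hd W L (by simp [hL])
    have h2 := card_nbhd_le U
    have h3 : L.card * (d + 1) ≤ 4 * U.card * (d + 1) := by nlinarith
    exact Nat.le_of_mul_le_mul_right h3 (by omega)
  · intro S hS hU
    -- Every boundary edge has an endpoint in `W`, so `S` is constant on components. Infinite
    -- components miss the finite set `S`, and small ones are in the filling.
    have hcomp : ∀ x ∉ W, ∀ y ∈ component W x, (x ∈ S ↔ y ∈ S) := by
      intro x hx y hy
      induction hy with
      | refl => rfl
      | @tail b c hb hbc ih =>
        obtain ⟨hc, e, rfl⟩ := hbc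
        rw [ih]
        by_contra hcross
        obtain ⟨u, hu, f, hf | hf⟩ := hU b e hcross
        · exact notMem_of_mem_component hx hb (mem_nbhd.2 ⟨u, hu, f, hf⟩)
        · exact hc (mem_nbhd.2 ⟨u, hu, f, hf⟩)
    refine mem_image.2 ⟨L.filter (· ⊆ S), mem_powerset.2 (filter_subset _ _), ?_⟩
    ext x
    simp only [Set.mem_iUnion, mem_filter, exists_prop, Set.mem_sdiff, mem_coe, hL,
      Set.Finite.mem_toFinset, mem_fill, not_or, not_lt]
    constructor
    · rintro ⟨C, ⟨⟨hfin, hcard, y, hy, rfl⟩, hCS⟩, hxC⟩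
      refine ⟨hCS hxC, notMem_of_mem_component hy hxC, ?_⟩
      rw [component_eq hy hxC, ← hfin.cast_ncard_eq]
      exact_mod_cast hcard
    · rintro ⟨hxS, hxW, hxc⟩
      have hsub : component W x ⊆ S := fun y hy => (hcomp x hxW y hy).1 hxS
      have hfin := hS.subset hsub
      rw [← hfin.cast_ncard_eq] at hxc
      exact ⟨component W x, ⟨⟨hfin, by exact_mod_cast hxc, x, hxW, rfl⟩, hsub⟩,
        self_mem_component W x⟩


/-! ### Refining an approximation inside the unknown region -/

/-- `A` approximates `S`, and its two parts are closed under passing to neighbours from `Ev` and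
from the complement of `Ev`, respectively. -/
structure ParityApproximates {d : ℕ} (S Ev : Set (Fin d → ℤ))
    (A : Set (Fin d → ℤ) × Set (Fin d → ℤ)) : Prop where
  subset : A.1 ⊆ S
  subset_compl : A.2 ⊆ Sᶜ
  closed : ∀ v ∈ A.1, v ∈ Ev → ∀ e, v + step e ∈ A.1
  closed' : ∀ v ∈ A.2, v ∉ Ev → ∀ e, v + step e ∈ A.2

/-- Add to `B` the vertices of `V ∩ E` and all their neighbours. -/
def extend {d : ℕ} (E B V : Set (Fin d → ℤ)) : Set (Fin d → ℤ) :=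
  {x | x ∈ B ∨ (x ∈ V ∧ x ∈ E) ∨ ∃ v ∈ V, v ∈ E ∧ ∃ e, x = v + step e}

lemma extend_subset {d : ℕ} {E B V S : Set (Fin d → ℤ)} (hB : B ⊆ S)
    (hV : ∀ v ∈ V, v ∈ E → v ∈ S) (hS : ∀ v ∈ S, v ∈ E → ∀ e, v + step e ∈ S) :
    extend E B V ⊆ S := by
  rintro x (hx | ⟨hx, hxE⟩ | ⟨v, hv, hvE, e, rfl⟩)
  · exact hB hx
  · exact hV x hx hxE
  · exact hS v (hV v hv hvE) hvE e

lemma extend_closed {d : ℕ} {E B V : Set (Fin d → ℤ)} (hE : IsParityClass E)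
    (hB : ∀ v ∈ B, v ∈ E → v ∈ V ∨ ∀ e, v + step e ∈ B) :
    ∀ v ∈ extend E B V, v ∈ E → ∀ e, v + step e ∈ extend E B V := by
  rintro x (hx | ⟨hx, -⟩ | ⟨v, hv, hvE, f, rfl⟩) hxE e
  · rcases hB x hx hxE with h | h
    · exact Or.inr (Or.inr ⟨x, h, hxE, e, rfl⟩)
    · exact Or.inl (h e)
  · exact Or.inr (Or.inr ⟨x, hx, hxE, e, rfl⟩)
  · exact absurd hvE ((hE v f).1 hxE)

/-- The pair obtained by closing `T` and the complement of `T ∪ Y`. -/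
def initialPair {d : ℕ} (Ev T Y : Set (Fin d → ℤ)) : Set (Fin d → ℤ) × Set (Fin d → ℤ) :=
  (extend Ev T T, extend Evᶜ (T ∪ Y)ᶜ (T ∪ Y)ᶜ)

lemma unknown_initialPair {d : ℕ} (Ev T Y : Set (Fin d → ℤ)) :
    unknown (initialPair Ev T Y) ⊆ Y := by
  intro x hx
  by_contra hY
  refine hx ?_
  by_cases hT : x ∈ T
  · exact Or.inl (Or.inl hT)
  · exact Or.inr (Or.inl fun h => h.elim hT hY)

lemma IsParityRegular.initialPair {d : ℕ} {S Ev : Set (Fin d → ℤ)} (hEv : IsParityClass Ev)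
    (hS : IsParityRegular S Ev) (Y : Set (Fin d → ℤ)) :
    ParityApproximates S Ev (initialPair Ev (S \ Y) Y) := by
  have h : ((S \ Y) ∪ Y)ᶜ ⊆ Sᶜ := fun x hx hxS => hx (by
    by_cases hY : x ∈ Y
    · exact Or.inr hY
    · exact Or.inl ⟨hxS, hY⟩)
  exact ⟨extend_subset (fun x hx => hx.1) (fun x hx _ => hx.1) hS.mem_closed,
    extend_subset h (fun x hx _ => h hx) hS.notMem_closed,
    extend_closed hEv fun v hv _ => Or.inl hv,
    extend_closed hEv.compl fun v hv _ => Or.inl hv⟩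

/-- Reveal the vertices of `V`, those in `Ev` as inside and the others as outside. -/
def reveal {d : ℕ} (Ev V : Set (Fin d → ℤ)) (A : Set (Fin d → ℤ) × Set (Fin d → ℤ)) :
    Set (Fin d → ℤ) × Set (Fin d → ℤ) :=
  (extend Ev A.1 V, extend Evᶜ A.2 V)

lemma ParityApproximates.reveal {d : ℕ} {S Ev : Set (Fin d → ℤ)} (hEv : IsParityClass Ev)
    (hS : IsParityRegular S Ev) {A : Set (Fin d → ℤ) × Set (Fin d → ℤ)}
    (hA : ParityApproximates S Ev A) {V : Set (Fin d → ℤ)} (hV : ∀ v ∈ V, v ∈ Ev ↔ v ∈ S) :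
    ParityApproximates S Ev (reveal Ev V A) :=
  ⟨extend_subset hA.subset (fun v hv h => (hV v hv).1 h) hS.mem_closed,
    extend_subset hA.subset_compl (fun v hv h h' => h ((hV v hv).2 h')) hS.notMem_closed,
    extend_closed hEv fun v hv h => Or.inr (hA.closed v hv h),
    extend_closed hEv.compl fun v hv h => Or.inr (hA.closed' v hv h)⟩

lemma unknown_reveal_subset {d : ℕ} (Ev V : Set (Fin d → ℤ))
    (A : Set (Fin d → ℤ) × Set (Fin d → ℤ)) : unknown (reveal Ev V A) ⊆ unknown A :=
  fun _ hx h => hx (h.imp Or.inl Or.inl)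

lemma notMem_of_mem_unknown_reveal {d : ℕ} {Ev V : Set (Fin d → ℤ)}
    {A : Set (Fin d → ℤ) × Set (Fin d → ℤ)} {x : Fin d → ℤ} (hx : x ∈ unknown (reveal Ev V A)) :
    x ∉ V := by
  intro h
  by_cases hE : x ∈ Ev
  · exact hx (Or.inl (Or.inr (Or.inl ⟨h, hE⟩)))
  · exact hx (Or.inr (Or.inr (Or.inl ⟨h, hE⟩)))

lemma step_notMem_unknown_reveal {d : ℕ} {Ev V : Set (Fin d → ℤ)}
    {A : Set (Fin d → ℤ) × Set (Fin d → ℤ)} {v : Fin d → ℤ} (hv : v ∈ V) (e : Fin d × Bool) :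
    v + step e ∉ unknown (reveal Ev V A) := by
  intro h
  by_cases hE : v ∈ Ev
  · exact h (Or.inl (Or.inr (Or.inr ⟨v, hv, hE, e, rfl⟩)))
  · exact h (Or.inr (Or.inr (Or.inr ⟨v, hv, hE, e, rfl⟩)))

open Classical in
/-- The number of unknown neighbours. -/
noncomputable def unknownDegree {d : ℕ} (A : Set (Fin d → ℤ) × Set (Fin d → ℤ))
    (v : Fin d → ℤ) : ℕ :=
  (univ.filter fun e => v + step e ∈ unknown A).card

lemma unknownDegree_mono {d : ℕ} {A A' : Set (Fin d → ℤ) × Set (Fin d → ℤ)}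
    (h : unknown A ⊆ unknown A') (v : Fin d → ℤ) : unknownDegree A v ≤ unknownDegree A' v := by
  classical
  exact card_le_card (monotone_filter_right _ fun e _ he => h he)

/-- Declare the unknown vertices with more than `t` unknown neighbours to be on the side of
their parity. -/
def prune {d : ℕ} (Ev : Set (Fin d → ℤ)) (t : ℕ) (A : Set (Fin d → ℤ) × Set (Fin d → ℤ)) :
    Set (Fin d → ℤ) × Set (Fin d → ℤ) :=
  (A.1 ∪ {v | v ∈ unknown A ∧ t < unknownDegree A v ∧ v ∉ Ev},
    A.2 ∪ {v | v ∈ unknown A ∧ t < unknownDegree A v ∧ v ∈ Ev})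

lemma unknown_prune_subset {d : ℕ} (Ev : Set (Fin d → ℤ)) (t : ℕ)
    (A : Set (Fin d → ℤ) × Set (Fin d → ℤ)) : unknown (prune Ev t A) ⊆ unknown A :=
  fun _ hx h => hx (h.imp Or.inl Or.inl)

lemma unknownDegree_prune_le {d : ℕ} {Ev : Set (Fin d → ℤ)} {t : ℕ}
    {A : Set (Fin d → ℤ) × Set (Fin d → ℤ)} {v : Fin d → ℤ} (hv : v ∈ unknown (prune Ev t A)) :
    unknownDegree (prune Ev t A) v ≤ t := by
  refine (unknownDegree_mono (unknown_prune_subset Ev t A) v).trans ?_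
  by_contra! h
  have hvA := unknown_prune_subset Ev t A hv
  by_cases hE : v ∈ Ev
  · exact hv (Or.inr (Or.inr ⟨hvA, h, hE⟩))
  · exact hv (Or.inl (Or.inr ⟨hvA, h, hE⟩))

lemma ParityApproximates.prune {d : ℕ} {S Ev : Set (Fin d → ℤ)}
    {A : Set (Fin d → ℤ) × Set (Fin d → ℤ)} (hA : ParityApproximates S Ev A) {t : ℕ}
    (h : ∀ v ∈ unknown A, t < unknownDegree A v → (v ∈ Ev ↔ v ∉ S)) :
    ParityApproximates S Ev (prune Ev t A) where
  subset := by
    rintro v (hv | ⟨hv, ht, hE⟩)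
    · exact hA.subset hv
    · exact not_not.1 fun hS => hE ((h v hv ht).2 hS)
  subset_compl := by
    rintro v (hv | ⟨hv, ht, hE⟩)
    · exact hA.subset_compl hv
    · exact (h v hv ht).1 hE
  closed := by
    rintro v (hv | ⟨hv, ht, hE⟩) hE' e
    · exact Or.inl (hA.closed v hv hE' e)
    · exact absurd hE' hE
  closed' := by
    rintro v (hv | ⟨hv, ht, hE⟩) hE' e
    · exact Or.inl (hA.closed' v hv hE' e)
    · exact absurd hE hE'

/-- Call `v` forcing if `v ∈ Ev ↔ v ∈ S`. Take `V` of maximal size among the sets of forcing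
vertices that have at least `t` unknown neighbours per element. A forcing vertex left with more than
`t` unknown neighbours could be added, so pruning errs nowhere. Neighbours of forcing vertices are
not forcing, so the unknown ones lie in `X`, which bounds |V|. -/
lemma ParityApproximates.exists_prune_reveal {d : ℕ} {S Ev : Set (Fin d → ℤ)}
    (hEv : IsParityClass Ev) (hS : IsParityRegular S Ev)
    {A : Set (Fin d → ℤ) × Set (Fin d → ℤ)} (hA : ParityApproximates S Ev A)
    {Y X : Finset (Fin d → ℤ)} (hY : unknown A ⊆ Y)
    (hX : ∀ v ∈ unknown A, (v ∈ Ev ↔ v ∉ S) → v ∈ X) (t : ℕ) :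
    ∃ V ⊆ Y, V.card * t ≤ X.card ∧
      ParityApproximates S Ev (OddCutset.prune Ev t (OddCutset.reveal Ev V A)) := by
  classical
  let gain : Finset (Fin d → ℤ) → Finset (Fin d → ℤ) := fun V =>
    (nbhd V).filter (· ∈ unknown A)
  let Q := Y.powerset.filter fun V => (∀ v ∈ V, v ∈ Ev ↔ v ∈ S) ∧ V.card * t ≤ (gain V).card
  have hQ : Q.Nonempty := ⟨∅, by simp [Q]⟩
  obtain ⟨V, hVQ, hmax⟩ := exists_max_image Q card hQ
  obtain ⟨hVY, hVS, hVt⟩ := by simpa only [Q, mem_filter, mem_powerset] using hVQ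
  refine ⟨V, hVY, hVt.trans (card_le_card ?_), ?_⟩
  · intro x hx
    obtain ⟨hxV, hxA⟩ := mem_filter.1 hx
    obtain ⟨v, hv, e, rfl⟩ := mem_nbhd.1 hxV
    refine hX _ hxA ?_
    rw [hEv, hVS v hv, not_iff_not]
    by_cases hvS : v ∈ S
    · exact iff_of_true hvS (hS.mem_closed v hvS ((hVS v hv).2 hvS) e)
    · exact iff_of_false hvS (hS.notMem_closed v hvS (fun h => hvS ((hVS v hv).1 h)) e)
  · refine (hA.reveal hEv hS hVS).prune fun v hv ht => ?_
    by_contra hne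
    have hvS : v ∈ Ev ↔ v ∈ S := by tauto
    have hvV : v ∉ V := notMem_of_mem_unknown_reveal hv
    have hvA := unknown_reveal_subset _ _ _ hv
    have hmem : insert v V ∈ Q := by
      simp only [Q, mem_filter, mem_powerset]
      refine ⟨insert_subset (hY hvA) hVY, ?_, ?_⟩
      · intro w hw
        rcases mem_insert.1 hw with rfl | hw
        · exact hvS
        · exact hVS w hw
      · let new := (univ.filter fun e => v + step e ∈ unknown (OddCutset.reveal Ev V A)).image
          fun e => v + step e
        have hnew : new.card = unknownDegree (OddCutset.reveal Ev V A) v :=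
          card_image_of_injective _ fun e f h => step_injective (add_left_cancel h)
        -- All neighbours of `V` are known after revealing, so the unknown neighbours of `v` are new
        -- gain.
        have hdisj : Disjoint (gain V) new := by
          rw [disjoint_left]
          intro x hx hx'
          obtain ⟨e, he, rfl⟩ := mem_image.1 hx'
          obtain ⟨u, hu, f, hf⟩ := mem_nbhd.1 (mem_filter.1 hx).1
          refine step_notMem_unknown_reveal (Ev := Ev) (A := A) (V := (V : Set (Fin d → ℤ)))
            hu f (hf ▸ (mem_filter.1 he).2)
        have hsub : gain V ∪ new ⊆ gain (insert v V) := by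
          intro x hx
          rcases mem_union.1 hx with hx | hx
          · obtain ⟨u, hu, f, hf⟩ := mem_nbhd.1 (mem_filter.1 hx).1
            exact mem_filter.2
              ⟨mem_nbhd.2 ⟨u, mem_insert_of_mem hu, f, hf⟩, (mem_filter.1 hx).2⟩
          · obtain ⟨e, he, rfl⟩ := mem_image.1 hx
            exact mem_filter.2 ⟨mem_nbhd.2 ⟨v, mem_insert_self _ _, e, rfl⟩,
              unknown_reveal_subset _ _ _ (mem_filter.1 he).2⟩
        have := card_le_card hsub
        rw [card_union_of_disjoint hdisj, hnew] at this
        rw [card_insert_of_notMem hvV, add_mul, one_mul]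
        omega
    have := hmax _ hmem
    rw [card_insert_of_notMem hvV] at this
    omega

/-- The unknown vertices that are not on the side of their parity have large cross degree. -/
lemma ParityApproximates.le_crossDegree {d : ℕ} {S Ev : Set (Fin d → ℤ)}
    (hEv : IsParityClass Ev) {A : Set (Fin d → ℤ) × Set (Fin d → ℤ)}
    (hA : ParityApproximates S Ev A) {v : Fin d → ℤ} (hv : v ∈ unknown A)
    (hvd : unknownDegree A v ≤ d) (hvS : v ∈ Ev ↔ v ∉ S) : d ≤ crossDegree S v := by
  classical
  have h1 := card_filter_add_card_filter_not (s := (univ : Finset (Fin d × Bool)))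
    fun e => v + step e ∈ unknown A
  rw [card_univ, card_steps] at h1
  -- A known neighbour did not force `v`, so it lies in `A.1` outside `Ev` or in `A.2` inside `Ev`.
  -- By `hvS`, the vertex `v` is then on the opposite side. At least `d` neighbours are known.
  have h2 : (univ.filter fun e => ¬ v + step e ∈ unknown A).card ≤ crossDegree S v := by
    refine card_le_card fun e he => ?_
    simp only [mem_filter, mem_univ, true_and, unknown, Set.mem_compl_iff, not_not] at he ⊢
    have hback := add_step_negStep v e
    rcases he with he | he
    · have hE : v + step e ∉ Ev := fun h =>
        hv (Or.inl (hback ▸ hA.closed _ he h (negStep e)))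
      have hvE : v ∈ Ev := not_not.1 fun h => hE ((hEv v e).2 h)
      exact fun h => hvS.1 hvE (h.2 (hA.subset he))
    · have hE : v + step e ∈ Ev := not_not.1 fun h =>
        hv (Or.inr (hback ▸ hA.closed' _ he h (negStep e)))
      have hvE : v ∉ Ev := (hEv v e).1 hE
      have hvS' : v ∈ S := not_not.1 fun h => hvE (hvS.2 h)
      exact fun h => hA.subset_compl he (h.1 hvS')
  unfold unknownDegree at hvd
  omega

/-- Decide the isolated unknown vertices. -/
def settle {d : ℕ} (Ev : Set (Fin d → ℤ)) (A : Set (Fin d → ℤ) × Set (Fin d → ℤ)) :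
    Set (Fin d → ℤ) × Set (Fin d → ℤ) :=
  (A.1 ∪ {v | v ∈ Ev ∧ ∀ e, v + step e ∈ A.1}, A.2 ∪ {v | v ∉ Ev ∧ ∀ e, v + step e ∈ A.2})

lemma unknown_settle_subset {d : ℕ} (Ev : Set (Fin d → ℤ))
    (A : Set (Fin d → ℤ) × Set (Fin d → ℤ)) : unknown (settle Ev A) ⊆ unknown A :=
  fun _ hx h => hx (h.imp Or.inl Or.inl)

/-- A vertex whose neighbours all lie on one side of `S` is on that side, since neither `S` nor its
complement has isolated vertices. -/
lemma ParityApproximates.settle {d : ℕ} {S Ev : Set (Fin d → ℤ)} (hS : IsParityRegular S Ev)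
    {A : Set (Fin d → ℤ) × Set (Fin d → ℤ)} (hA : ParityApproximates S Ev A) :
    ParityApproximates S Ev (settle Ev A) where
  subset := by
    rintro v (hv | ⟨-, hv⟩)
    · exact hA.subset hv
    · by_contra h
      obtain ⟨e, he⟩ := hS.notMem_neighbor v h
      exact he (hA.subset (hv e))
  subset_compl := by
    rintro v (hv | ⟨-, hv⟩)
    · exact hA.subset_compl hv
    · intro h
      obtain ⟨e, he⟩ := hS.mem_neighbor v h
      exact hA.subset_compl (hv e) he
  closed := by
    rintro v (hv | ⟨-, hv⟩) hE e
    · exact Or.inl (hA.closed v hv hE e)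
    · exact Or.inl (hv e)
  closed' := by
    rintro v (hv | ⟨-, hv⟩) hE e
    · exact Or.inl (hA.closed' v hv hE e)
    · exact Or.inl (hv e)

/-- Let `v ∈ Ev` stay unknown. Some neighbour is not in `A.1`; it is not in `A.2` either, as it
would have forced `v`. Settling cannot decide it, since that needs `v` in `A.2`. The other parity is
symmetric. -/
lemma ParityApproximates.noIsolated_settle {d : ℕ} {S Ev : Set (Fin d → ℤ)}
    (hEv : IsParityClass Ev) {A : Set (Fin d → ℤ) × Set (Fin d → ℤ)}
    (hA : ParityApproximates S Ev A) :
    NoIsolated (lattice d) (unknown (OddCutset.settle Ev A)) := by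
  intro v hv
  have hvA := unknown_settle_subset Ev A hv
  have hback := add_step_negStep v
  by_cases hE : v ∈ Ev
  · have h1 : ∃ e, v + step e ∉ A.1 := by
      by_contra! h
      exact hv (Or.inl (Or.inr ⟨hE, h⟩))
    obtain ⟨e, he⟩ := h1
    have hE' : v + step e ∉ Ev := fun h => (hEv v e).1 h hE
    have h2 : v + step e ∉ A.2 := fun h =>
      hvA (Or.inr (hback e ▸ hA.closed' _ h hE' (negStep e)))
    refine ⟨v + step e, ?_, adj_step v e⟩
    rintro ((h | ⟨h, -⟩) | (h | ⟨-, h⟩))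
    · exact he h
    · exact hE' h
    · exact h2 h
    · exact hvA (Or.inr (hback e ▸ h (negStep e)))
  · have h1 : ∃ e, v + step e ∉ A.2 := by
      by_contra! h
      exact hv (Or.inr (Or.inr ⟨hE, h⟩))
    obtain ⟨e, he⟩ := h1
    have hE' : v + step e ∈ Ev := (hEv v e).2 hE
    have h2 : v + step e ∉ A.1 := fun h =>
      hvA (Or.inl (hback e ▸ hA.closed _ h hE' (negStep e)))
    refine ⟨v + step e, ?_, adj_step v e⟩
    rintro ((h | ⟨-, h⟩) | (h | ⟨h, -⟩))
    · exact h2 h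
    · exact hvA (Or.inl (hback e ▸ h (negStep e)))
    · exact he h
    · exact h hE'

lemma ParityApproximates.isApproximation {d : ℕ} {S : Set (Fin d → ℤ)}
    {A : Set (Fin d → ℤ) × Set (Fin d → ℤ)}
    (hA : ParityApproximates S (evenVertices d) A) : IsApproximation A where
  disjoint := Set.disjoint_left.2 fun _ h1 h2 => hA.subset_compl h2 (hA.subset h1)
  odd := by
    rintro v ⟨hv, w, hw, hvw⟩
    obtain ⟨e, rfl⟩ := adj_iff.1 hvw
    exact (isOddVertex_iff v).2 fun h => hw (hA.closed v hv h e)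
  even := by
    rintro v ⟨hv, w, hw, hvw⟩
    obtain ⟨e, rfl⟩ := adj_iff.1 hvw
    exact (isEvenVertex_iff v).2 (not_not.1 fun h => hw (hA.closed' v hv h e))

lemma encard_neighborSet_inter_le {d : ℕ} (A : Set (Fin d → ℤ) × Set (Fin d → ℤ))
    (v : Fin d → ℤ) :
    ((lattice d).neighborSet v ∩ unknown A).encard ≤ unknownDegree A v := by
  classical
  have : (lattice d).neighborSet v ∩ unknown A ⊆
      ((univ.filter fun e => v + step e ∈ unknown A).image fun e => v + step e :
        Finset (Fin d → ℤ)) := by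
    rintro w ⟨hw, hwA⟩
    obtain ⟨e, rfl⟩ := adj_iff.1 hw
    exact mem_coe.2 (mem_image_of_mem _ (mem_filter.2 ⟨mem_univ _, hwA⟩))
  refine (Set.encard_le_encard this).trans ?_
  rw [Set.encard_coe_eq_coe_finsetCard]
  exact_mod_cast card_image_le

/-- The `t`-approximation read off from the trace `T` outside `Y` and two revealed sets. -/
def decode {d : ℕ} (t : ℕ) (Y T V₁ V₂ : Set (Fin d → ℤ)) :
    Set (Fin d → ℤ) × Set (Fin d → ℤ) :=
  settle (evenVertices d) (prune (evenVertices d) t (reveal (evenVertices d) V₂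
    (prune (evenVertices d) d (reveal (evenVertices d) V₁ (initialPair (evenVertices d) T Y)))))

/-- The first round, at threshold `d`, has the trivial gain bound |Y|. It leaves unknown degrees at
most `d`, so the non-forcing unknown vertices have `d` boundary edges each and the second round
gains at most 2n/d. -/
lemma exists_decode {d n : ℕ} {t : ℕ} {S : Set (Fin d → ℤ)}
    (hS : IsParityRegular S (evenVertices d)) (hn : (edgeBoundary (lattice d) S).encard = n)
    (Y : Finset (Fin d → ℤ)) :
    ∃ V₁ ⊆ Y, ∃ V₂ ⊆ Y, V₁.card * d ≤ Y.card ∧ V₂.card * (d * t) ≤ 2 * n ∧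
      IsTApproximation t (decode t (Y : Set (Fin d → ℤ)) (S \ Y) V₁ V₂) ∧
      Approximates (decode t (Y : Set (Fin d → ℤ)) (S \ Y) V₁ V₂) S := by
  classical
  have hEv := isParityClass_evenVertices d
  have hY₀ := unknown_initialPair (evenVertices d) (S \ Y) (Y : Set (Fin d → ℤ))
  obtain ⟨V₁, hV₁, hc₁, hA₁⟩ := (hS.initialPair hEv (Y : Set (Fin d → ℤ))).exists_prune_reveal
    hEv hS hY₀ (fun v hv _ => hY₀ hv) d
  set A₁ := prune (evenVertices d) d (reveal (evenVertices d) V₁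
    (initialPair (evenVertices d) (S \ Y) Y)) with hA₁def
  have hY₁ : unknown A₁ ⊆ Y :=
    (unknown_prune_subset _ _ _).trans ((unknown_reveal_subset _ _ _).trans hY₀)
  let X := Y.filter fun v => v ∈ unknown A₁ ∧ (v ∈ evenVertices d ↔ v ∉ S)
  have hX : X.card * d ≤ 2 * n := by
    have := card_mul_le_of_le_crossDegree hn X (m := d) fun v hv => by
      obtain ⟨-, hvA, hvS⟩ := mem_filter.1 hv
      exact_mod_cast hA₁.le_crossDegree hEv hvA (unknownDegree_prune_le hvA) hvS
    exact_mod_cast this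
  obtain ⟨V₂, hV₂, hc₂, hA₂⟩ := hA₁.exists_prune_reveal (X := X) hEv hS hY₁
    (fun v hv hvS => mem_filter.2 ⟨hY₁ hv, hv, hvS⟩) t
  have hA₃ := hA₂.settle hS
  refine ⟨V₁, hV₁, V₂, hV₂, hc₁, ?_, ⟨hA₃.isApproximation, ?_, ?_⟩,
    hA₃.subset, hA₃.subset_compl⟩
  · calc V₂.card * (d * t) = V₂.card * t * d := by ring
      _ ≤ X.card * d := Nat.mul_le_mul_right _ hc₂
      _ ≤ 2 * n := hX
  · intro v hv
    refine (encard_neighborSet_inter_le _ v).trans ?_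
    have h1 := unknown_settle_subset _ _ hv
    have h2 := (unknownDegree_mono (unknown_settle_subset (evenVertices d) _) v).trans
      (unknownDegree_prune_le h1)
    exact_mod_cast h2
  · exact hA₂.noIsolated_settle hEv

end OddCutset

/-! ### Counting the codes -/

open Finset in
/-- The number of subsets of size at most `k`. -/
lemma Finset.card_powerset_filter_card_le {α : Type*} (Y : Finset α) (k : ℕ) {c : ℝ}
    (hc : 1 ≤ c) :
    ((Y.powerset.filter fun V => V.card ≤ k).card : ℝ) ≤
      Real.exp (Y.card / c + k * Real.log c) := by
  have hc0 : 0 < c := by linarith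
  -- Give `V` the weight c^{-|V|}: each counted set weighs at least c^{-k}, and all subsets together
  -- weigh (1 + 1/c)^{|Y|}.
  have h1 : ((Y.powerset.filter fun V => V.card ≤ k).card : ℝ) * c⁻¹ ^ k ≤
      (c⁻¹ + 1) ^ Y.card := by
    calc ((Y.powerset.filter fun V => V.card ≤ k).card : ℝ) * c⁻¹ ^ k
        ≤ ∑ V ∈ Y.powerset.filter fun V => V.card ≤ k, c⁻¹ ^ V.card := by
          rw [← nsmul_eq_mul]
          refine card_nsmul_le_sum _ _ _ fun V hV => ?_
          exact pow_le_pow_of_le_one (by positivity) (inv_le_one_of_one_le₀ hc)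
            (mem_filter.1 hV).2
      _ ≤ ∑ V ∈ Y.powerset, c⁻¹ ^ V.card :=
          sum_le_sum_of_subset_of_nonneg (filter_subset _ _) fun _ _ _ => by positivity
      _ = (c⁻¹ + 1) ^ Y.card := by
          rw [← sum_pow_mul_eq_add_pow]
          simp
  have h2 : (c⁻¹ + 1) ^ Y.card ≤ Real.exp (Y.card / c) := by
    calc (c⁻¹ + 1) ^ Y.card ≤ Real.exp c⁻¹ ^ Y.card :=
          pow_le_pow_left₀ (by positivity) (Real.add_one_le_exp _) _
      _ = Real.exp (Y.card / c) := by rw [← Real.exp_nat_mul, div_eq_mul_inv]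
  have h3 : Real.exp (k * Real.log c) = c ^ k := by
    rw [Real.exp_nat_mul, Real.exp_log hc0]
  rw [Real.exp_add, h3]
  rw [inv_pow, ← div_eq_mul_inv, div_le_iff₀ (by positivity)] at h1
  exact h1.trans (by gcongr)

namespace OddCutset

open Finset

lemma scale_pow_three {d : ℕ} (hd : 2 ≤ d) :
    scale d ^ 3 = (Real.log d / d) ^ (3 / 2 : ℝ) := by
  have h0 : 0 ≤ Real.log d / d := div_nonneg (log_pos_of_two_le hd).le (by positivity)
  rw [scale, Real.sqrt_eq_rpow, ← Real.rpow_natCast, ← Real.rpow_mul h0]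
  norm_num

lemma sepSize_mul_log_le {d : ℕ} (hd : 2 ≤ d) (n : ℕ) :
    sepSize d n * Real.log d ≤ 24 * (n * scale d ^ 3) := by
  have h0 : (0 : ℝ) < d := by exact_mod_cast (by omega : 0 < d)
  have hq := scale_pos hd
  have h1 : (sepSize d n : ℝ) ≤ 24 * n * scale d / d := Nat.floor_le (by positivity)
  rw [← scale_sq hd]
  calc (sepSize d n : ℝ) * (d * scale d ^ 2) ≤ 24 * n * scale d / d * (d * scale d ^ 2) := by
        gcongr
    _ = _ := by field_simp

/-- Absorbs the number of roots on a ray. With y = n q / d ≥ 1/24 one has 2n ≤ e^y d³, and both y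
and 3 log d are bounded by multiples of y log d = n q³: 3/2 + 72 ≤ 74. -/
lemma two_mul_le_exp {d n : ℕ} (hd : 2 ≤ d) (hK : 1 ≤ sepSize d n) :
    (2 * n : ℝ) ≤ Real.exp (74 * (n * scale d ^ 3)) := by
  have h0 : (0 : ℝ) < d := by exact_mod_cast (by omega : 0 < d)
  have hd2 : (2 : ℝ) ≤ d := by exact_mod_cast hd
  have hq := scale_pos hd
  have hqs := scale_sq hd
  have hl := two_thirds_le_log hd
  set q := scale d
  set l := Real.log d with hldef
  set y := n * q / d with hy
  have hy0 : 0 ≤ y := by positivity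
  have hy1 : 1 / 24 ≤ y := by
    have h1 : (sepSize d n : ℝ) ≤ 24 * n * q / d := Nat.floor_le (by positivity)
    have h2 : (1 : ℝ) ≤ sepSize d n := by exact_mod_cast hK
    have h3 : 24 * n * q / d = 24 * y := by rw [hy]; ring
    linarith
  have hyl : y * l = n * q ^ 3 := by
    rw [← hqs, hy]
    field_simp
  have hdq : 1 ≤ d * q := by
    have : 1 ≤ (d * q) ^ 2 := by
      have : (d * q) ^ 2 = d * l := by rw [← hqs]; ring
      rw [this]
      nlinarith
    exact (one_le_sq_iff₀ (by positivity)).1 this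
  have hexpl : Real.exp l = d := Real.exp_log h0
  have h4 : (2 * n : ℝ) ≤ Real.exp (y + 3 * l) := by
    have h5 : (n : ℝ) * (d * q) = y * d ^ 2 := by rw [hy]; field_simp
    have h6 : Real.exp (y + 3 * l) = Real.exp y * d ^ 3 := by
      rw [Real.exp_add, show (3 : ℝ) * l = (3 : ℕ) * l by norm_num, Real.exp_nat_mul, hexpl]
    have h7 : y ≤ Real.exp y := by linarith [Real.add_one_le_exp y]
    rw [h6]
    calc (2 * n : ℝ) ≤ d * (n * (d * q)) := by
          have h8 : (n : ℝ) ≤ n * (d * q) := le_mul_of_one_le_right (by positivity) hdq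
          gcongr
      _ = y * d ^ 3 := by rw [h5]; ring
      _ ≤ Real.exp y * d ^ 3 := by gcongr
  refine h4.trans (Real.exp_le_exp.2 ?_)
  rw [← hyl]
  nlinarith

lemma log_two_mul_add_one_le {d : ℕ} (hd : 2 ≤ d) : Real.log (2 * d + 1) ≤ 3 * Real.log d := by
  have hd2 : (2 : ℝ) ≤ d := by exact_mod_cast hd
  have : Real.log ((d : ℝ) ^ 3) = 3 * Real.log d := by simp
  rw [← this]
  refine Real.log_le_log (by positivity) ?_
  nlinarith [mul_nonneg (by linarith : (0 : ℝ) ≤ d - 2) (by positivity : (0 : ℝ) ≤ (d : ℝ) ^ 2),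
    mul_nonneg (by linarith : (0 : ℝ) ≤ d - 2) (by linarith : (0 : ℝ) ≤ d)]

/-- The number of codes is at most the claimed bound. -/
lemma card_bound {d n r t : ℕ} (hd : 2 ≤ d) (hr : 1 ≤ r) (ht : 1 ≤ t)
    (hK : 1 ≤ sepSize d n) {M : ℕ} (hM : (M : ℝ) ≤ 2 * n / (d * t)) {a b : ℝ}
    (ha : a ≤ Real.exp ((6 * d * sepSize d n) / d ^ 2 +
      (6 * sepSize d n : ℕ) * Real.log ((d : ℝ) ^ 2)))
    (hb : b ≤ Real.exp ((6 * d * sepSize d n) / d ^ 2 + M * Real.log ((d : ℝ) ^ 2)))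
    (ha0 : 0 ≤ a) (hb0 : 0 ≤ b) :
    (((2 * d + 1) ^ r * (2 * n) * (2 * d + 1) ^ 2 *
        ((2 * d + 1) ^ (r + 5)) ^ (2 * sepSize d n) : ℕ) : ℝ) *
      ((2 ^ (4 * sepSize d n) : ℕ) * (a * b)) ≤
    Real.exp (2000 * n * r * (Real.log d / d) ^ (3 / 2 : ℝ) + 2000 * n * Real.log d / (d * t)) := by
  have h0 : (0 : ℝ) < d := by exact_mod_cast (by omega : 0 < d)
  have ht0 : (0 : ℝ) < t := by exact_mod_cast ht
  have hd2 : (2 : ℝ) ≤ d := by exact_mod_cast hd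
  have hr1 : (1 : ℝ) ≤ r := by exact_mod_cast hr
  have hK1 : (1 : ℝ) ≤ sepSize d n := by exact_mod_cast hK
  have hn2 := two_mul_le_exp hd hK
  have hKl := sepSize_mul_log_le hd n
  have hL := log_two_mul_add_one_le hd
  have hl := two_thirds_le_log hd
  rw [← scale_pow_three hd]
  have hz : 0 ≤ n * scale d ^ 3 := by have := scale_pos hd; positivity
  set K := sepSize d n
  set z := n * scale d ^ 3 with hzdef
  set l := Real.log d with hldef
  set L := Real.log (2 * d + 1) with hLdef
  have hexpL : ∀ m : ℕ, ((2 * d + 1 : ℝ)) ^ m = Real.exp (m * L) := fun m => by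
    rw [Real.exp_nat_mul, hLdef, Real.exp_log (by positivity)]
  have h2exp : ((2 : ℝ)) ^ (4 * K) ≤ Real.exp (4 * K) := by
    calc ((2 : ℝ)) ^ (4 * K) ≤ Real.exp 1 ^ (4 * K) := by
          gcongr
          have := Real.add_one_le_exp (1 : ℝ)
          linarith
      _ = Real.exp (4 * K) := by rw [← Real.exp_nat_mul]; push_cast; ring_nf
  have hlog2 : Real.log ((d : ℝ) ^ 2) = 2 * l := by simp [hldef]
  have hfrac : 6 * d * K / (d : ℝ) ^ 2 ≤ 3 * K := by
    rw [div_le_iff₀ (by positivity)]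
    have : 0 ≤ d * (K : ℝ) * (d - 2) := by
      have : (0 : ℝ) ≤ d - 2 := by linarith
      positivity
    nlinarith
  rw [hlog2] at ha hb
  push_cast at ha ⊢
  rw [← pow_mul]
  calc _ ≤ Real.exp (r * L) * Real.exp (74 * z) * Real.exp ((2 : ℕ) * L) *
        Real.exp (((r + 5) * (2 * K) : ℕ) * L) * (Real.exp (4 * K) *
          (Real.exp (6 * d * K / d ^ 2 + 6 * K * (2 * l)) *
            Real.exp (6 * d * K / d ^ 2 + M * (2 * l)))) := by
        rw [hexpL, hexpL, hexpL]
        gcongr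
    _ = Real.exp (r * L + 74 * z + (2 : ℕ) * L + ((r + 5) * (2 * K) : ℕ) * L + (4 * K +
          ((6 * d * K / d ^ 2 + 6 * K * (2 * l)) + (6 * d * K / d ^ 2 + M * (2 * l))))) := by
        simp only [Real.exp_add]
    _ ≤ _ := by
        refine Real.exp_le_exp.2 ?_
        push_cast
        have hl0 : 0 ≤ l := by linarith
        have hMl : M * (2 * l) ≤ 4 * n * l / (d * t) := by
          calc M * (2 * l) ≤ 2 * n / (d * t) * (2 * l) := by gcongr
            _ = _ := by ring
        have hMl' : 4 * n * l / (d * t) ≤ 2000 * n * l / (d * t) := by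
          gcongr
          norm_num
        have hrL : r * L + 2 * L + (r + 5) * (2 * K) * L ≤ 45 * (r * (K * l)) := by
          have e1 : r * L + 2 * L ≤ 3 * r * (3 * l) := by
            calc r * L + 2 * L = (r + 2) * L := by ring
              _ ≤ (r + 2) * (3 * l) := by gcongr
              _ ≤ 3 * r * (3 * l) := by gcongr; linarith
          have e2 : 3 * r * (3 * l) ≤ 9 * (r * (K * l)) := by
            have : l ≤ K * l := le_mul_of_one_le_left hl0 hK1
            calc 3 * r * (3 * l) = 9 * (r * l) := by ring
              _ ≤ 9 * (r * (K * l)) := by gcongr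
          have e3 : (r + 5) * (2 * K) * L ≤ 36 * (r * (K * l)) := by
            have hL0 : 0 ≤ L := Real.log_nonneg (by linarith)
            calc (r + 5) * (2 * K) * L ≤ (6 * r) * (2 * K) * (3 * l) := by
                  gcongr
                  linarith
              _ = _ := by ring
          linarith
        have hKK : (K : ℝ) ≤ 3 / 2 * (K * l) := by nlinarith
        have hrKl : K * l ≤ r * (K * l) := le_mul_of_one_le_left (by positivity) hr1
        have hrz : z ≤ r * z := le_mul_of_one_le_left hz hr1
        have hrKz : r * (K * l) ≤ r * (24 * z) := by gcongr
        -- In multiples of r K log d: 45 from the walks, 12 from the first revealed set, 15 from the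
        -- 10K that remains. With K log d ≤ 24z and the 74z above, 72 · 24 + 74 ≤ 2000.
        have hfin : 2000 * n * r * scale d ^ 3 = 2000 * (r * z) := by rw [hzdef]; ring
        rw [hfin]
        linarith

end OddCutset

/-! ### The proposition -/

open OddCutset in
theorem proposition3p3 :
    ∃ C : ℝ, 0 < C ∧ ∀ d : ℕ, 2 ≤ d → ∀ n r t : ℕ, 1 ≤ n → 1 ≤ r → 1 ≤ t → t < 2 * d →
      ∃ 𝒜 : Finset (Set (Fin d → ℤ) × Set (Fin d → ℤ)),
        (∀ A ∈ 𝒜, OddCutset.IsTApproximation t A) ∧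
        (𝒜.card : ℝ) ≤ Real.exp
          (C * n * r * (Real.log d / d) ^ (3 / 2 : ℝ) + C * n * Real.log d / (d * t)) ∧
        ∀ S ∈ OddCutset.oddCutsets d n r, ∃ A ∈ 𝒜, OddCutset.Approximates A S := by
  classical
  refine ⟨2000, by norm_num, fun d hd n r t _ hr ht _ => ?_⟩
  have hd0 : 0 < d := by omega
  have hdR : (0 : ℝ) < d := by exact_mod_cast hd0
  have htR : (0 : ℝ) < t := by exact_mod_cast ht
  obtain ⟨𝒰, h𝒰c, h𝒰⟩ := exists_separating_family hd n hr
  by_cases hK : 1 ≤ sepSize d n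
  swap
  -- If K = 0 there are no odd cutsets at all: a separating set would be nonempty of size 0.
  · refine ⟨∅, by simp, by simpa using (Real.exp_pos _).le, fun S hS => ?_⟩
    obtain ⟨U, -, hU, hUK, -⟩ := h𝒰 S hS
    have := hU.card_pos
    omega
  choose 𝒯 h𝒯c h𝒯 using exists_trace_family (d := d) hd0
  let Y : Finset (Fin d → ℤ) → Finset (Fin d → ℤ) := fun U => fill hd0 (nbhd U)
  let K := sepSize d n
  let M := ⌊(2 * n : ℝ) / (d * t)⌋₊
  have hM : (M : ℝ) ≤ 2 * n / (d * t) := Nat.floor_le (by positivity)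
  let sub : ℕ → Finset (Fin d → ℤ) → Finset (Finset (Fin d → ℤ)) := fun k U =>
    (Y U).powerset.filter fun V => V.card ≤ k
  let codes : Finset (Fin d → ℤ) → Finset (Set (Fin d → ℤ) × Set (Fin d → ℤ)) := fun U =>
    (𝒯 U ×ˢ (sub (6 * K) U ×ˢ sub M U)).image fun p => decode t (Y U) p.1 p.2.1 p.2.2
  let big := ((𝒰.filter fun U => U.card ≤ K).biUnion codes)
  refine ⟨big.filter (IsTApproximation t), fun A hA => (Finset.mem_filter.1 hA).2, ?_, ?_⟩
  · have hYc : ∀ U : Finset (Fin d → ℤ), U.card ≤ K → (Y U).card ≤ 6 * d * K := fun U hU => by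
      have h1 := card_fill_le hd0 (nbhd U)
      have h2 := card_nbhd_le U
      have h3 : U.card * (2 * d) ≤ K * (2 * d) := Nat.mul_le_mul_right _ hU
      calc (Y U).card ≤ 3 * (nbhd U).card := h1
        _ ≤ 3 * (K * (2 * d)) := by omega
        _ = 6 * d * K := by ring
    have hsub : ∀ k U, U.card ≤ K → ((sub k U).card : ℝ) ≤
        Real.exp ((6 * d * K) / d ^ 2 + k * Real.log ((d : ℝ) ^ 2)) := fun k U hU => by
      -- With c = d² the term |Y|/c is at most 6K/d, while log c = 2 log d.
      refine (Finset.card_powerset_filter_card_le (Y U) k (c := (d : ℝ) ^ 2)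
        (one_le_pow₀ (by exact_mod_cast hd0))).trans (Real.exp_le_exp.2 ?_)
      gcongr
      exact_mod_cast hYc U hU
    set a := Real.exp ((6 * d * K) / d ^ 2 + (6 * K : ℕ) * Real.log ((d : ℝ) ^ 2)) with ha
    set b := Real.exp ((6 * d * K) / d ^ 2 + M * Real.log ((d : ℝ) ^ 2)) with hb
    have hcodes : ∀ U : Finset (Fin d → ℤ), U.card ≤ K →
        ((codes U).card : ℝ) ≤ (2 ^ (4 * K) : ℕ) * (a * b) := fun U hU => by
      have h1 : (codes U).card ≤ (𝒯 U).card * ((sub (6 * K) U).card * (sub M U).card) := by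
        refine Finset.card_image_le.trans ?_
        rw [Finset.card_product, Finset.card_product]
      have h2 : (𝒯 U).card ≤ 2 ^ (4 * K) :=
        (h𝒯c U).trans (Nat.pow_le_pow_right (by norm_num) (by omega))
      calc ((codes U).card : ℝ)
          ≤ (𝒯 U).card * ((sub (6 * K) U).card * (sub M U).card) := by exact_mod_cast h1
        _ ≤ (2 ^ (4 * K) : ℕ) * (a * b) := by
            have h3 : ((𝒯 U).card : ℝ) ≤ (2 ^ (4 * K) : ℕ) := by exact_mod_cast h2
            have h4 := hsub (6 * K) U hU
            have h5 := hsub M U hU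
            gcongr
    have hbig : (big.card : ℝ) ≤ 𝒰.card * ((2 ^ (4 * K) : ℕ) * (a * b)) := by
      calc (big.card : ℝ) ≤ ∑ U ∈ 𝒰.filter fun U => U.card ≤ K, ((codes U).card : ℝ) := by
            exact_mod_cast Finset.card_biUnion_le
        _ ≤ (𝒰.filter fun U => U.card ≤ K).card * ((2 ^ (4 * K) : ℕ) * (a * b)) := by
            rw [← nsmul_eq_mul]
            exact Finset.sum_le_card_nsmul _ _ _ fun U hU => hcodes U (Finset.mem_filter.1 hU).2
        _ ≤ 𝒰.card * ((2 ^ (4 * K) : ℕ) * (a * b)) := by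
            gcongr
            exact Finset.filter_subset _ _
    calc ((big.filter (IsTApproximation t)).card : ℝ) ≤ big.card := by
          exact_mod_cast Finset.card_filter_le _ _
      _ ≤ 𝒰.card * ((2 ^ (4 * K) : ℕ) * (a * b)) := hbig
      _ ≤ _ := by
          refine le_trans ?_ (card_bound hd hr ht hK hM (a := a) (b := b) le_rfl le_rfl
            (Real.exp_pos _).le (Real.exp_pos _).le)
          have : (𝒰.card : ℝ) ≤ ((2 * d + 1) ^ r * (2 * n) * (2 * d + 1) ^ 2 *
              ((2 * d + 1) ^ (r + 5)) ^ (2 * sepSize d n) : ℕ) := by exact_mod_cast h𝒰c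
          gcongr
  · intro S hS
    obtain ⟨U, hU𝒰, -, hUK, hUS⟩ := h𝒰 S hS
    obtain ⟨hcut, hodd, hn, -⟩ := hS
    have hreg := isParityRegular_of_isOddSet hcut.regular hodd
    obtain ⟨V₁, hV₁, V₂, hV₂, hc₁, hc₂, hT, hA⟩ := exists_decode hreg hn (Y U)
    refine ⟨_, Finset.mem_filter.2 ⟨Finset.mem_biUnion.2 ⟨U, Finset.mem_filter.2 ⟨hU𝒰, hUK⟩,
      Finset.mem_image.2 ⟨(S \ Y U, V₁, V₂), ?_, rfl⟩⟩, hT⟩, hA⟩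
    simp only [Finset.mem_product, sub, Finset.mem_filter, Finset.mem_powerset]
    refine ⟨h𝒯 U S hcut.finite hUS, ⟨hV₁, ?_⟩, hV₂, ?_⟩
    · have h1 := card_fill_le hd0 (nbhd U)
      have h2 := card_nbhd_le U
      have h3 : U.card * (2 * d) ≤ K * (2 * d) := Nat.mul_le_mul_right _ hUK
      have h4 : V₁.card * d ≤ 6 * K * d := by
        calc V₁.card * d ≤ 3 * (nbhd U).card := hc₁.trans h1
          _ ≤ 3 * (K * (2 * d)) := by omega
          _ = 6 * K * d := by ring
      exact Nat.le_of_mul_le_mul_right h4 hd0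
    · refine Nat.le_floor ?_
      rw [le_div_iff₀ (by positivity)]
      exact_mod_cast hc₂
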